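/- **Theorem (the lookback call in the subordinated Black–Scholes model).** Let $Z_0>0$, $\mu\in\mathbb R$, $\sigma>0$, $r\neq 0$, $T>0$. Let $\nu$ be a measure on $(0,\infty)$ with $\int_0^\infty \min(1,x)\,\nu(dx)<\infty$ and $\nu(0,\infty)=\infty$, and put $\psi(u)=\int_0^\infty(1-e^{-ux})\,\nu(dx)$. On a probability space $(\Omega,\mathcal F,\mathbb P)$ let $U$ be a subordinator (a nondecreasing càdlàg Lévy process) with $\mathbb E\,e^{-uU(t)}=e^{-t\psi(u)}$ for $u>0$, let $S(t)=\inf\{\tau>0: U(\tau)>t\}$ be its inverse, and let $B$ be a standard Brownian motion such that the processes $S$ and $B$ are independent. Put $Z(t)=Z_0\exp(\mu t+\sigma B(t))$, $Z_S(t)=Z(S(t))$ and $\gamma=(\mu-r+\sigma^2/2)/\sigma$. For a time $\tau$, possibly random, let $$\mathbb Q_\tau(A)=\int_A \exp\Big(-\gamma B(\tau)-\frac{\gamma^2}{2}\tau\Big)\,d\mathbb P,\qquad A\in\mathcal F.$$ The fair price of the floating-strike European lookback call with expiry $\tau$ in the classical model, and with expiry $T$ in the subordinated model, is $$\mathbb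 E^{\mathbb Q_\tau}\Big[e^{-r\tau}\Big(Z(\tau)-\min_{0\le t\le \tau}Z(t)\Big)\Big],\qquad C^L_S(T)=\mathbb E^{\mathbb Q_{S(T)}}\Big[e^{-rS(T)}\Big(Z_S(T)-\min_{0\le t\le T}Z_S(t)\Big)\Big],$$ respectively (in the first expression $\tau\ge 0$ is a constant). Let $\Phi$ be the standard normal distribution function and, for $x\ge 0$, $$C^L(x)=Z_0\Big(1+\frac{\sigma^2}{2r}\Big)\Phi\Big(\Big(\frac r\sigma+\frac\sigma2\Big)\sqrt x\Big)-Z_0e^{-rx}\Big(1-\frac{\sigma^2}{2r}\Big)\Phi\Big(\Big(\frac r\sigma-\frac\sigma2\Big)\sqrt x\Big)-Z_0\frac{\sigma^2}{2r}.$$ 1. For every $\tau\ge 0$ the discounted payoff of the classical model is $\mathbb Q_\tau$-integrable, and the classical fair price equals $C^L(\tau)$. 2. The discounted payoff of the subordinated model is $\mathbb Q_{S(T)}$-integrable, $C^L(S(T))$ is $\mathbb P$-integrable, and $$C^L_S(T)=\mathbb E\,C^L(S(T)).$$ 3. If moreover $\psi(u)=u^\alpha$ for all $u>0$, for some $\alpha\in(0,1)$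 (the inverse $\alpha$-stable subordinator), then there is a function $g_\alpha$, nonnegative on $(0,\infty)$, given there by the Fox function $$g_\alpha(z)=H^{1,0}_{1,1}\Big(z\,\Big|\,{(1-\alpha,\alpha)\atop(0,1)}\Big)=\frac1{2\pi i}\int_{c-i\infty}^{c+i\infty}\frac{\Gamma(s)}{\Gamma(1-\alpha+\alpha s)}\,z^{-s}\,ds\qquad\text{for every } c>0,\ z>0,$$ such that $S(T)$ has the density $x\mapsto T^{-\alpha}g_\alpha(x/T^\alpha)$ on $(0,\infty)$, the integrand below is integrable, and $$C^L_S(T)=\int_0^\infty C^L(x)\,T^{-\alpha}g_\alpha(x/T^\alpha)\,dx.$$ -/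

import Mathlib

open MeasureTheory ProbabilityTheory
open scoped NNReal ENNReal

noncomputable section

namespace SubordinatedBS

/-! ### Subordinators and their inverses -/

/-- The Lévy measures considered: measures on `(0, ∞)` (only the restriction of `ν` to `(0, ∞)` is
ever used) with `∫ min(1, x) ν(dx) < ∞` and infinite total mass. -/
structure IsInfiniteLevyMeasure (ν : Measure ℝ) : Prop where
  lintegral_min_lt_top : ∫⁻ x in Set.Ioi (0 : ℝ), ENNReal.ofReal (min 1 x) ∂ν < ∞
  infinite : ν (Set.Ioi 0) = ∞

/-- The Laplace exponent `ψ(u) = ∫_{(0,∞)} (1 - e^{-u x}) ν(dx)`. -/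
def laplaceExponent (ν : Measure ℝ) (u : ℝ) : ℝ :=
  ∫ x in Set.Ioi (0 : ℝ), (1 - Real.exp (-(u * x))) ∂ν

/-- `U` is a subordinator (a càdlàg Lévy process with nondecreasing paths) without drift and with
Lévy measure `ν`, that is `E exp(-u U(t)) = exp(-t ψ(u))`. -/
structure IsSubordinator {Ω : Type*} {mΩ : MeasurableSpace Ω} (U : ℝ≥0 → Ω → ℝ) (ν : Measure ℝ)
    (P : Measure Ω) : Prop where
  aemeasurable : ∀ t, AEMeasurable (U t) P
  zero : ∀ᵐ ω ∂P, U 0 ω = 0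
  indep_increments : HasIndepIncrements U P
  stationary_increments : ∀ s t, IdentDistrib (fun ω ↦ U (s + t) ω - U s ω) (U t) P P
  right_continuous : ∀ᵐ ω ∂P, ∀ t, ContinuousWithinAt (fun s ↦ U s ω) (Set.Ici t) t
  left_limits : ∀ᵐ ω ∂P, ∀ t, ∃ l : ℝ,
    Filter.Tendsto (fun s ↦ U s ω) (nhdsWithin t (Set.Iio t)) (nhds l)
  monotone : ∀ᵐ ω ∂P, Monotone fun s ↦ U s ω
  laplace : ∀ (t : ℝ≥0) (u : ℝ), 0 < u →
    ∫ ω, Real.exp (-(u * U t ω)) ∂P = Real.exp (-(t * laplaceExponent ν u))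

/-- The inverse `S(t) = inf {τ > 0 : U(τ) > t}`. -/
def inverseSubordinator {Ω : Type*} (U : ℝ≥0 → Ω → ℝ) (t : ℝ≥0) (ω : Ω) : ℝ≥0 :=
  sInf {τ : ℝ≥0 | 0 < τ ∧ (t : ℝ) < U τ ω}

/-! ### The price processes, the martingale measure and the fair prices -/

/-- Geometric Brownian motion `Z(t) = Z₀ exp(μ t + σ B(t))`. -/
def gbm {Ω : Type*} (Z₀ μ σ : ℝ) (B : ℝ≥0 → Ω → ℝ) (t : ℝ≥0) (ω : Ω) : ℝ :=
  Z₀ * Real.exp (μ * t + σ * B t ω)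

/-- Subordinated geometric Brownian motion `Z_S(t) = Z(S(t))`. -/
def subordinatedGBM {Ω : Type*} (Z₀ μ σ : ℝ) (B : ℝ≥0 → Ω → ℝ) (S : ℝ≥0 → Ω → ℝ≥0)
    (t : ℝ≥0) (ω : Ω) : ℝ :=
  gbm Z₀ μ σ B (S t ω) ω

/-- The parameter `γ = (μ - r + σ² / 2) / σ`. -/
def gammaParam (r μ σ : ℝ) : ℝ := (μ - r + σ ^ 2 / 2) / σ

/-- The measure `Q(A) = ∫_A exp(-γ B(τ) - γ² τ / 2) dP` for a (possibly random) time `τ`: the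
subordinated model uses `τ = S(T)`, the classical model the constant time `τ = T`. -/
def martingaleMeasure {Ω : Type*} {mΩ : MeasurableSpace Ω} (P : Measure Ω) (r μ σ : ℝ)
    (B : ℝ≥0 → Ω → ℝ) (τ : Ω → ℝ≥0) : Measure Ω :=
  P.withDensity fun ω ↦ ENNReal.ofReal (Real.exp
    (-(gammaParam r μ σ) * B (τ ω) ω - gammaParam r μ σ ^ 2 / 2 * τ ω))

/-- The payoff `X(T) - min_{t ∈ [0,T]} X(t)` of the floating-strike lookback call. -/
def lookbackPayoff {Ω : Type*} (X : ℝ≥0 → Ω → ℝ) (T : ℝ≥0) (ω : Ω) : ℝ :=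
  X T ω - sInf ((fun t ↦ X t ω) '' Set.Icc 0 T)

/-- The discounted payoff in the classical model. -/
def classicalDiscountedPayoff {Ω : Type*} (Z₀ r μ σ : ℝ) (B : ℝ≥0 → Ω → ℝ) (T : ℝ≥0) (ω : Ω) : ℝ :=
  Real.exp (-(r * T)) * lookbackPayoff (gbm Z₀ μ σ B) T ω

/-- The discounted payoff in the subordinated model. -/
def subordinatedDiscountedPayoff {Ω : Type*} (Z₀ r μ σ : ℝ) (B : ℝ≥0 → Ω → ℝ)
    (S : ℝ≥0 → Ω → ℝ≥0) (T : ℝ≥0) (ω : Ω) : ℝ :=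
  Real.exp (-(r * S T ω)) * lookbackPayoff (subordinatedGBM Z₀ μ σ B S) T ω

/-- The fair price of the lookback call with expiry `T` in the classical model. -/
def classicalLookbackPrice {Ω : Type*} {mΩ : MeasurableSpace Ω} (P : Measure Ω) (Z₀ r μ σ : ℝ)
    (B : ℝ≥0 → Ω → ℝ) (T : ℝ≥0) : ℝ :=
  ∫ ω, classicalDiscountedPayoff Z₀ r μ σ B T ω ∂(martingaleMeasure P r μ σ B fun _ ↦ T)

/-- The fair price of the lookback call with expiry `T` in the subordinated model. -/
def subordinatedLookbackPrice {Ω : Type*} {mΩ : MeasurableSpace Ω} (P : Measure Ω)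
    (Z₀ r μ σ : ℝ) (B : ℝ≥0 → Ω → ℝ) (S : ℝ≥0 → Ω → ℝ≥0) (T : ℝ≥0) : ℝ :=
  ∫ ω, subordinatedDiscountedPayoff Z₀ r μ σ B S T ω ∂(martingaleMeasure P r μ σ B (S T))

/-- The standard normal distribution function. -/
def Phi (x : ℝ) : ℝ := cdf (gaussianReal 0 1) x

/-- The semi-explicit formula for the classical lookback call with expiry `T`. -/
def lookbackFormula (Z₀ r σ T : ℝ) : ℝ :=
  Z₀ * (1 + σ ^ 2 / (2 * r)) * Phi ((r / σ + σ / 2) * √T)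
    - Z₀ * Real.exp (-(r * T)) * (1 - σ ^ 2 / (2 * r)) * Phi ((r / σ - σ / 2) * √T)
    - Z₀ * (σ ^ 2 / (2 * r))

/-! ### Fox H-functions -/

/-- The kernel
`∏_{j ≤ m} Γ(b_j + B_j s) ∏_{i ≤ n} Γ(1 - a_i - A_i s) /
  (∏_{j > m} Γ(1 - b_j - B_j s) ∏_{i > n} Γ(a_i + A_i s))`
of the Fox function `H^{m,n}_{p,q}` with upper parameters `(a_i, A_i)` and lower parameters
`(b_j, B_j)`. (Mathlib's `Complex.Gamma` is `0` at its poles, so that a pole in the denominator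
gives the value `0`, as it should.) -/
def foxHKernel {p q : ℕ} (m n : ℕ) (a A : Fin p → ℝ) (b B : Fin q → ℝ) (s : ℂ) : ℂ :=
  ((∏ j with j.val < m, Complex.Gamma (b j + B j * s)) *
      ∏ i with i.val < n, Complex.Gamma (1 - a i - A i * s)) /
    ((∏ j with m ≤ j.val, Complex.Gamma (1 - b j - B j * s)) *
      ∏ i with n ≤ i.val, Complex.Gamma (a i + A i * s))

/-- The Fox function as a Mellin–Barnes integral `(1 / 2πi) ∫ kernel(s) z^{-s} ds` along the
vertical line `Re s = c`, where `c` has to be such that the line separates the poles of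
`Γ(b_j + B_j s)`, `j ≤ m` (on its left), from those of `Γ(1 - a_i - A_i s)`, `i ≤ n`
(on its right). -/
def foxH {p q : ℕ} (m n : ℕ) (a A : Fin p → ℝ) (b B : Fin q → ℝ) (c z : ℝ) : ℂ :=
  mellinInv c (foxHKernel m n a A b B) z

end SubordinatedBS

end

/-! ### The reflection principle for Brownian motion with drift -/

namespace SubordinatedBS

/-! Classical price. The price is `Z₀ exp(-σ W)` with `W(s) = -B(s) - (μ/σ) s`, so its minimum is
governed by the running maximum of `W`. Under the martingale measure `W` has drift `b = σ/2 - r/σ`,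
from which `μ` has disappeared. The law of the maximum comes from a weighted reflection principle,
`lintegral_reflection`: the weight `exp(-d · endpoint)` removes the drift `d` up to a constant, so
reflecting the path after its first passage of `m` preserves weighted expectations. On a finite grid
this needs only independent increments and the symmetry of the centred Gaussian; continuity of paths
removes the overshoot as the mesh tends to zero. Integrating the tail of the maximum by layers
(`integral_exp_neg_runMax`) yields the closed formula. Being the expectation of a nonnegative payoff
dominated by a martingale, it lies in `[0, Z₀]`.

Time change. Infinite Lévy mass forces `ψ(n) → ∞`, hence almost surely strictly increasing and
unbounded paths of `U`. The inverse `S` then has no jumps and maps `[0, T]` onto `[0, S(T)]`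
(`inverseSubordinator_image`), so the subordinated payoff is, path by path, the classical payoff
with expiry `S(T)`. Since `S(T)` is independent of `B`, Fubini gives `E C^L(S(T))`
(`integral_classicalDiscountedPayoff_random`). The joint measurability in expiry and path that this
requires is obtained by sampling the path at countably many times.

Stable case. Up to boundary cases `S(T) < x` means `U(x) > T`, and the law of `x U(x)^(-α)` does not
depend on `x`, so `S(T)` has the law of `T^α U(1)^(-α)`. Negative moments follow from the Laplace
transform by a Gamma integral; analytic continuation gives `E (U(1)^(-α))^(s-1) = Γ(s)/Γ(1-α+αs)`
for `Re s > 0` (`IsPositiveStable.complexMGF_logScaled`). This ratio is integrable on vertical lines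
because `α < 1`. Fourier inversion on `Re s = 1` produces a continuous density of the logarithm, and
Mellin inversion on `Re s = c` identifies the density of `U(1)^(-α)` with the Fox function. -/

/-- Completing the square: an exponential tilt by `c` shifts the mean by `c v`. The degenerate
variance is a Dirac mass and is treated apart. -/
lemma lintegral_exp_mul_gaussianReal (m c : ℝ) (v : ℝ≥0) {h : ℝ → ℝ≥0∞} (hh : Measurable h) :
    ∫⁻ y, ENNReal.ofReal (Real.exp (c * y)) * h y ∂gaussianReal m v =
      ENNReal.ofReal (Real.exp (c * m + v * c ^ 2 / 2)) * ∫⁻ y, h y ∂gaussianReal (m + c * v) v := by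
  rcases eq_or_ne v 0 with rfl | hv
  · simp [gaussianReal_zero_var, lintegral_dirac]
  rw [gaussianReal_of_var_ne_zero _ hv, gaussianReal_of_var_ne_zero _ hv,
    lintegral_withDensity_eq_lintegral_mul _ (measurable_gaussianPDF _ _) (by fun_prop),
    lintegral_withDensity_eq_lintegral_mul _ (measurable_gaussianPDF _ _) hh,
    ← lintegral_const_mul _ ((measurable_gaussianPDF _ _).mul hh)]
  refine lintegral_congr fun y => ?_
  simp only [Pi.mul_apply, ← mul_assoc]
  congr 1
  rw [gaussianPDF, gaussianPDF, ← ENNReal.ofReal_mul (gaussianPDFReal_nonneg _ _ _),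
    ← ENNReal.ofReal_mul (Real.exp_pos _).le]
  congr 1
  rw [gaussianPDFReal, gaussianPDFReal, mul_left_comm, mul_assoc, ← Real.exp_add,
    ← Real.exp_add]
  congr 2
  have : (v : ℝ) ≠ 0 := by exact_mod_cast hv
  field_simp
  ring

/-- The reflection of a drifted Gaussian increment. -/
lemma lintegral_reflect_gaussianReal (d : ℝ) (v : ℝ≥0) {h : ℝ → ℝ≥0∞} (hh : Measurable h) :
    ∫⁻ y, ENNReal.ofReal (Real.exp (-d * (y + d * v))) * h (y + d * v) ∂gaussianReal 0 v =
    ∫⁻ y, ENNReal.ofReal (Real.exp (-d * (y + d * v))) * h (-(y + d * v)) ∂gaussianReal 0 v := by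
  -- The weight `exp(-d x)` turns N(dv, v) into a multiple of N(0, v), which is symmetric.
  have key (k : ℝ → ℝ≥0∞) (hk : Measurable k) :
      ∫⁻ y, ENNReal.ofReal (Real.exp (-d * (y + d * v))) * k (y + d * v) ∂gaussianReal 0 v =
      ENNReal.ofReal (Real.exp (-d * (d * v) + v * (-d) ^ 2 / 2)) *
        ∫⁻ y, k y ∂gaussianReal 0 v := by
    have h1 := lintegral_map (μ := gaussianReal 0 v) (g := fun y : ℝ => y + d * v)
      (f := fun y => ENNReal.ofReal (Real.exp (-d * y)) * k y) (by fun_prop) (by fun_prop)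
    rw [gaussianReal_map_add_const, lintegral_exp_mul_gaussianReal _ _ _ hk] at h1
    rw [← h1]
    simp
  rw [key h hh, key (fun y => h (-y)) (by fun_prop)]
  congr 1
  have h2 := lintegral_map (μ := gaussianReal 0 v) (g := fun y : ℝ => -y) hh (by fun_prop)
  rw [gaussianReal_map_neg, neg_zero] at h2
  exact h2

variable {Ω : Type*} [MeasurableSpace Ω] {P : Measure Ω} {B : ℝ≥0 → Ω → ℝ}

/-- Reflecting, after time `s`, a Brownian motion with drift `d` on an event of the past. -/
lemma lintegral_reflect_increment [IsProbabilityMeasure P] (hB : IsPreBrownianReal B P) (d : ℝ)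
    {s t : ℝ≥0} (hst : s ≤ t) {u : ℕ → ℝ≥0} (hu : ∀ i, u i ≤ s)
    {A : (ℕ → ℝ) → ℝ≥0∞} (hA : Measurable A)
    {G : ℝ → ℝ≥0∞} (hG : Measurable G) :
    ∫⁻ ω, A (fun i => B (u i) ω) * (ENNReal.ofReal (Real.exp (-d * (B t ω + d * t))) *
        G (B t ω + d * t)) ∂P =
    ∫⁻ ω, A (fun i => B (u i) ω) * (ENNReal.ofReal (Real.exp (-d * (B t ω + d * t))) *
        G (2 * (B s ω + d * s) - (B t ω + d * t))) ∂P := by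
  obtain ⟨v, rfl⟩ : ∃ v, t = s + v := ⟨t - s, by simp [hst]⟩
  have hlaw : HasLaw (fun ω => B (s + v) ω - B s ω) (gaussianReal 0 v) P :=
    (hB.shift s).hasLaw_eval v
  set X : Ω → ℝ≥0∞ × ℝ := fun ω => (A (fun i => B (u i) ω), B s ω) with hX
  have hXm : AEMeasurable X P :=
    (hA.comp_aemeasurable (aemeasurable_pi_lambda _ fun i => hB.aemeasurable (u i))).prodMk (hB.aemeasurable s)
  have hind : IndepFun X (fun ω => B (s + v) ω - B s ω) P := by
    have hφ : Measurable fun p : Set.Iic s → ℝ => p ⟨s, Set.mem_Iic.2 le_rfl⟩ :=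
      measurable_pi_apply _
    have hψ : Measurable fun q : ℝ≥0 → ℝ => q v := measurable_pi_apply v
    have := (hB.indepFun_shift s).symm.comp
      (φ := fun p : Set.Iic s → ℝ => (A (fun i => p ⟨u i, hu i⟩), p ⟨s, Set.mem_Iic.2 le_rfl⟩))
      (ψ := fun q : ℝ≥0 → ℝ => q v)
      ((hA.comp (measurable_pi_lambda _ fun i => measurable_pi_apply _)).prodMk
        hφ) hψ
    exact this
  have hmap := (indepFun_iff_map_prod_eq_prod_map_map hXm hlaw.aemeasurable).1 hind
  have : IsProbabilityMeasure (P.map X) := Measure.isProbabilityMeasure_map hXm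
  rw [hlaw.map_eq] at hmap
  have key (F : (ℝ≥0∞ × ℝ) × ℝ → ℝ≥0∞) (hF : Measurable F) :
      ∫⁻ ω, F (X ω, B (s + v) ω - B s ω) ∂P = ∫⁻ x, ∫⁻ y, F (x, y) ∂gaussianReal 0 v ∂P.map X := by
    rw [← lintegral_prod _ hF.aemeasurable, ← hmap, lintegral_map' hF.aemeasurable
      (hXm.prodMk hlaw.aemeasurable)]
  have e1 := key (fun p => p.1.1 * (ENNReal.ofReal (Real.exp (-d * (p.1.2 + d * s + (p.2 + d * v)))) *
    G (p.1.2 + d * s + (p.2 + d * v)))) (by fun_prop)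
  have e2 := key (fun p => p.1.1 * (ENNReal.ofReal (Real.exp (-d * (p.1.2 + d * s + (p.2 + d * v)))) *
    G (p.1.2 + d * s + -(p.2 + d * v)))) (by fun_prop)
  -- With the past frozen, the weight splits into a factor known at time `s` and the weight of the
  -- increment, to which the Gaussian reflection applies.
  have e3 : ∀ x : ℝ≥0∞ × ℝ, ∫⁻ y, x.1 * (ENNReal.ofReal
      (Real.exp (-d * (x.2 + d * s + (y + d * v)))) * G (x.2 + d * s + (y + d * v)))
        ∂gaussianReal 0 v = ∫⁻ y, x.1 * (ENNReal.ofReal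
      (Real.exp (-d * (x.2 + d * s + (y + d * v)))) * G (x.2 + d * s + -(y + d * v)))
        ∂gaussianReal 0 v := by
    intro x
    have h4 := lintegral_reflect_gaussianReal d v (h := fun z => G (x.2 + d * s + z)) (by fun_prop)
    rw [lintegral_const_mul _ (by fun_prop), lintegral_const_mul _ (by fun_prop)]
    simp only [mul_add (-d) (x.2 + d * s), Real.exp_add, ENNReal.ofReal_mul (Real.exp_pos _).le,
      mul_assoc (ENNReal.ofReal (Real.exp (-d * (x.2 + d * s))))]
    rw [lintegral_const_mul _ (by fun_prop), lintegral_const_mul _ (by fun_prop), h4]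
  simp only [e3] at e1
  have := e1.trans e2.symm
  simp only [hX] at this
  have h5 : ∀ ω, B s ω + d * s + (B (s + v) ω - B s ω + d * v) =
      B (s + v) ω + d * (s + v : ℝ≥0) := fun ω => by push_cast; ring
  have h6 : ∀ ω, B s ω + d * s + -(B (s + v) ω - B s ω + d * v) =
      2 * (B s ω + d * s) - (B (s + v) ω + d * (s + v : ℝ≥0)) := fun ω => by push_cast; ring
  simpa only [h5, h6] using this

open Classical in
/-- Along finer and finer grids, the value at the first passage above the level `m` tends to `m`. -/
lemma tendsto_sum_first_passage {f : ℝ≥0 → ℝ} (hf : Continuous f) {m : ℝ} (h0 : f 0 ≤ m)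
    (τ : ℝ≥0) {φ : ℝ → ℝ≥0∞} (hφ : ContinuousAt φ m) :
    Filter.Tendsto (fun n : ℕ => ∑ k ∈ Finset.range (n + 2),
      if m < f (τ * (k / (n + 1))) ∧ ∀ j < k, f (τ * (j / (n + 1))) ≤ m
        then φ (f (τ * (k / (n + 1)))) else 0) Filter.atTop
      (nhds (if ∃ s ≤ τ, m < f s then φ m else 0)) := by
  by_cases h : ∃ s ≤ τ, m < f s
  · obtain ⟨s, hs, hms⟩ := h
    rw [if_pos ⟨s, hs, hms⟩]
    have hτ : 0 < τ := by
      rcases eq_or_ne τ 0 with rfl | h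
      · rw [nonpos_iff_eq_zero.1 hs] at hms
        exact absurd hms h0.not_gt
      · exact pos_of_ne_zero h
    intro V hV
    obtain ⟨δ, hδ, hball⟩ := Metric.mem_nhds_iff.1 (hφ hV)
    -- `δ` controls the overshoot at first passage; the margin `f s - m` makes a grid point close to
    -- `s` lie above `m`.
    obtain ⟨η, hη, hunif⟩ := Metric.uniformContinuousOn_iff.1
      ((isCompact_Icc (a := (0 : ℝ≥0)) (b := τ)).uniformContinuousOn_of_continuous
        hf.continuousOn) (min δ (f s - m)) (lt_min hδ (sub_pos.2 hms))
    obtain ⟨N, hN⟩ := exists_nat_gt ((τ : ℝ) / η)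
    rw [Filter.mem_map]
    filter_upwards [Filter.eventually_ge_atTop N] with n hn
    have hn1 : (0 : ℝ) < n + 1 := by positivity
    have hmesh : (τ : ℝ) / (n + 1) < η := by
      rw [div_lt_iff₀ hn1]
      rw [div_lt_iff₀ hη] at hN
      have : (N : ℝ) ≤ n := by exact_mod_cast hn
      nlinarith
    have hgrid (k : ℕ) (hk : k ≤ n + 1) : τ * (k / (n + 1)) ∈ Set.Icc 0 τ := by
      refine ⟨zero_le, mul_le_of_le_one_right zero_le ?_⟩
      rw [div_le_one (by positivity)]
      exact_mod_cast hk
    have hex : ∃ k : ℕ, k ≤ n + 1 ∧ m < f (τ * (k / (n + 1))) := by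
      -- The last grid point to the left of `s`, within one mesh of it.
      refine ⟨⌊(s : ℝ) * (n + 1) / τ⌋₊, ?_⟩
      set k := ⌊(s : ℝ) * (n + 1) / τ⌋₊ with hk
      have hτ' : (0 : ℝ) < τ := by exact_mod_cast hτ
      have hsτ : (s : ℝ) ≤ τ := by exact_mod_cast hs
      have h1 : (k : ℝ) ≤ s * (n + 1) / τ := Nat.floor_le (by positivity)
      have h2 : s * (n + 1) / τ < (k : ℝ) + 1 := Nat.lt_floor_add_one _
      rw [le_div_iff₀ hτ'] at h1
      rw [div_lt_iff₀ hτ'] at h2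
      have hk1 : k ≤ n + 1 := by
        have : (k : ℝ) * τ ≤ (n + 1) * τ := by nlinarith
        have := le_of_mul_le_mul_right this hτ'
        exact_mod_cast this
      have hd : dist (τ * (k / (n + 1))) s < η := by
        rw [NNReal.dist_eq]
        push_cast
        refine lt_of_le_of_lt ?_ hmesh
        rw [abs_le]
        constructor
        · rw [← sub_nonneg]
          have : (τ * (k / (n + 1)) - s - -(τ / (n + 1)) : ℝ) =
            ((k + 1) * τ - s * (n + 1)) / (n + 1) := by field_simp; ring
          rw [this]
          exact div_nonneg (by linarith) hn1.le
        · rw [← sub_nonneg]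
          have : (τ / (n + 1) - (τ * (k / (n + 1)) - s) : ℝ) =
            (τ + s * (n + 1) - k * τ) / (n + 1) := by field_simp; ring
          rw [this]
          exact div_nonneg (by linarith) hn1.le
      have := (hunif _ (hgrid k hk1) s ⟨zero_le, hs⟩ hd).trans_le (min_le_right _ _)
      rw [Real.dist_eq, abs_lt] at this
      exact ⟨hk1, by linarith⟩
    obtain ⟨k, hkn, hk, hmin⟩ : ∃ k : ℕ, k ≤ n + 1 ∧ m < f (τ * (k / (n + 1))) ∧
        ∀ j < k, f (τ * (j / (n + 1))) ≤ m :=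
      ⟨Nat.find hex, (Nat.find_spec hex).1, (Nat.find_spec hex).2, fun j hj =>
        not_lt.1 fun hlt => Nat.find_min hex hj ⟨hj.le.trans (Nat.find_spec hex).1, hlt⟩⟩
    rw [Set.mem_preimage]
    rw [Finset.sum_eq_single k, if_pos ⟨hk, hmin⟩]
    -- Since `f 0 ≤ m`, the first passage index is positive. Its predecessor has value at most `m`
    -- and is one mesh away, so the overshoot is below `δ`.
    · obtain ⟨l, rfl⟩ : ∃ l, k = l + 1 := by
        refine Nat.exists_eq_succ_of_ne_zero ?_
        rintro rfl
        simp only [CharP.cast_eq_zero, zero_div, mul_zero] at hk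
        exact absurd hk h0.not_gt
      refine hball ?_
      have h1 := hmin l (Nat.lt_succ_self l)
      have hd : dist (τ * ((l + 1 : ℕ) / (n + 1))) (τ * (l / (n + 1))) < η := by
        rw [NNReal.dist_eq]
        push_cast
        have : (τ * ((l + 1) / (n + 1)) - τ * (l / (n + 1)) : ℝ) = τ / (n + 1) := by
          field_simp; ring
        rwa [this, abs_of_nonneg (by positivity)]
      have h2 := (hunif _ (hgrid _ hkn) _ (hgrid l (by omega)) hd).trans_le (min_le_left _ _)
      rw [Real.dist_eq, abs_lt] at h2
      rw [Metric.mem_ball, Real.dist_eq, abs_lt]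
      constructor <;> linarith
    · intro j hj hjk
      refine if_neg ?_
      rintro ⟨h1, h2⟩
      rcases lt_or_gt_of_ne hjk with h | h
      · exact absurd h1 (hmin j h).not_gt
      · exact absurd hk (h2 k h).not_gt
    · intro h
      exact absurd (Finset.mem_range.2 (by omega)) h
  · rw [if_neg h]
    push Not at h
    refine tendsto_const_nhds.congr fun n => (Finset.sum_eq_zero fun k hk => if_neg ?_).symm
    rintro ⟨h1, -⟩
    refine absurd h1 (h _ (mul_le_of_le_one_right zero_le ?_)).not_gt
    rw [div_le_one (by positivity)]
    exact_mod_cast Nat.lt_succ_iff.1 (Finset.mem_range.1 hk)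

open Classical in
-- The first-passage conditions exclude one another, so at most one term is nonzero. This supplies
-- the dominating function when the mesh tends to zero.
lemma sum_first_passage_le (x : ℕ → ℝ) (m : ℝ) {φ : ℝ → ℝ≥0∞} {K : ℝ≥0∞} (hφ : ∀ x, φ x ≤ K) (n : ℕ) :
    ∑ k ∈ Finset.range n, (if m < x k ∧ ∀ j < k, x j ≤ m then φ (x k) else 0) ≤ K := by
  by_cases h : ∃ k ∈ Finset.range n, m < x k ∧ ∀ j < k, x j ≤ m
  · obtain ⟨k, hkn, hk, hmin⟩ := h
    rw [Finset.sum_eq_single_of_mem k hkn, if_pos ⟨hk, hmin⟩]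
    · exact hφ _
    · intro j hj hjk
      refine if_neg ?_
      rintro ⟨h1, h2⟩
      rcases lt_or_gt_of_ne hjk with h | h
      · exact absurd h1 (hmin j h).not_gt
      · exact absurd hk (h2 k h).not_gt
  · push Not at h
    rw [Finset.sum_eq_zero]
    · exact zero_le
    · intro k hk
      refine if_neg ?_
      rintro ⟨h1, h2⟩
      obtain ⟨j, hj, hj'⟩ := h k hk h1
      exact absurd (h2 j hj) hj'.not_ge

open Classical in
/-- The **reflection principle** for Brownian motion with drift. -/
theorem lintegral_reflection [IsProbabilityMeasure P] (hB : IsBrownianReal B P) (d : ℝ)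
    {τ : ℝ≥0} (hτ : 0 < τ) {m : ℝ} (hm : 0 ≤ m) {G : ℝ → ℝ≥0∞} (hG : Measurable G)
    {K : ℝ≥0∞} (hK : K ≠ ∞) (hGK : ∀ x, G x ≤ K) (hGc : ∀ x ≠ m, ContinuousAt G x) :
    ∫⁻ ω, (if ∃ s ≤ τ, m < B s ω + d * s then
      ENNReal.ofReal (Real.exp (-d * (B τ ω + d * τ))) * G (B τ ω + d * τ) else 0) ∂P =
    ∫⁻ ω, (if ∃ s ≤ τ, m < B s ω + d * s then
      ENNReal.ofReal (Real.exp (-d * (B τ ω + d * τ))) * G (2 * m - (B τ ω + d * τ))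
        else 0) ∂P := by
  set w : Ω → ℝ≥0∞ := fun ω => ENNReal.ofReal (Real.exp (-d * (B τ ω + d * τ))) with hw
  have hlaw := hB.hasLaw_eval τ
  have hBm : ∀ t, AEMeasurable (B t) P := hB.aemeasurable
  have hwm : AEMeasurable w P := by fun_prop
  have hwint : ∫⁻ ω, w ω * K ∂P ≠ ∞ := by
    rw [lintegral_mul_const' _ _ hK]
    refine ENNReal.mul_ne_top ?_ hK
    have := hlaw.lintegral_comp (f := fun y => ENNReal.ofReal (Real.exp (-d * (y + d * τ))))
      (by fun_prop)
    rw [hw, this]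
    have h2 := lintegral_exp_mul_gaussianReal 0 (-d) τ
      (h := fun _ => ENNReal.ofReal (Real.exp (-d * (d * τ)))) (by fun_prop)
    simp only [mul_add, Real.exp_add, ENNReal.ofReal_mul (Real.exp_pos _).le] at h2 ⊢
    rw [h2]
    simp [ENNReal.mul_eq_top]
  -- The Gaussian endpoint almost surely avoids `m`, the only possible discontinuity of `G`.
  have hne : ∀ᵐ ω ∂P, B τ ω + d * τ ≠ m := by
    have : ∀ᵐ x ∂(P.map (B τ)), x ≠ m - d * τ := by
      rw [hlaw.map_eq]
      have := nullSingletonClass_gaussianReal (μ := 0) hτ.ne'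
      rw [ae_iff]
      simp
    filter_upwards [ae_of_ae_map hlaw.aemeasurable this] with ω h1 h2
    exact h1 (by linarith)
  have hpast (n k : ℕ) : Measurable (fun q : ℕ → ℝ =>
      if m < q k + d * (τ * (k / (n + 1)) : ℝ≥0) ∧
        ∀ j < k, q j + d * (τ * (j / (n + 1)) : ℝ≥0) ≤ m then (1 : ℝ≥0∞) else 0) := by
    refine Measurable.ite ?_ measurable_const measurable_const
    refine (measurableSet_lt measurable_const ((measurable_pi_apply k).add_const _)).inter
      (?_ : MeasurableSet {q : ℕ → ℝ | ∀ j < k, q j + d * (τ * (j / (n + 1)) : ℝ≥0) ≤ m})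
    simp only [Set.ofPred_forall]
    refine MeasurableSet.iInter fun j => MeasurableSet.iInter fun _ => ?_
    exact measurableSet_le (by fun_prop) measurable_const
  have hterm (n : ℕ) (Ψ : ℝ → ℝ → ℝ≥0∞) (hΨ : Measurable (Function.uncurry Ψ)) (k : ℕ) :
      AEMeasurable (fun ω => if m < B (τ * (k / (n + 1))) ω + d * (τ * (k / (n + 1)) : ℝ≥0) ∧
          ∀ j < k, B (τ * (j / (n + 1))) ω + d * (τ * (j / (n + 1)) : ℝ≥0) ≤ m then
          w ω * Ψ (B (τ * (k / (n + 1))) ω + d * (τ * (k / (n + 1)) : ℝ≥0)) (B τ ω + d * τ)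
          else 0) P := by
    have h1 := (hpast n k).comp_aemeasurable
      (aemeasurable_pi_lambda (μ := P) (fun ω (j : ℕ) => B (τ * (j / (n + 1))) ω) fun j => hBm _)
    have h2 := hΨ.comp_aemeasurable (f := fun ω =>
      (B (τ * (k / (n + 1))) ω + d * (τ * (k / (n + 1)) : ℝ≥0), B τ ω + d * τ)) (μ := P)
      (by fun_prop)
    refine (h1.mul (hwm.mul h2)).congr (Filter.Eventually.of_forall fun ω => ?_)
    simp [Function.uncurry]
  -- The arguments of `Φ` are the value at the first grid passage and the value at time `τ`; in the
  -- limit the former becomes `m`.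
  have hlim (Φ : ℝ → ℝ → ℝ≥0∞) (hΦm : Measurable (Function.uncurry Φ)) (hΦK : ∀ x y, Φ x y ≤ K)
      (hΦc : ∀ y ≠ m, ContinuousAt (fun x => Φ x y) m) :
      Filter.Tendsto (fun n : ℕ => ∫⁻ ω, ∑ k ∈ Finset.range (n + 2),
        (if m < B (τ * (k / (n + 1))) ω + d * (τ * (k / (n + 1)) : ℝ≥0) ∧
          ∀ j < k, B (τ * (j / (n + 1))) ω + d * (τ * (j / (n + 1)) : ℝ≥0) ≤ m then
          w ω * Φ (B (τ * (k / (n + 1))) ω + d * (τ * (k / (n + 1)) : ℝ≥0)) (B τ ω + d * τ)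
          else 0) ∂P) Filter.atTop
        (nhds (∫⁻ ω, (if ∃ s ≤ τ, m < B s ω + d * s then
          w ω * Φ m (B τ ω + d * τ) else 0) ∂P)) := by
    refine tendsto_lintegral_of_dominated_convergence' (fun ω => w ω * K) (fun n => ?_)
      (fun n => ?_) hwint ?_
    · exact Finset.aemeasurable_fun_sum _ fun k _ => hterm n Φ hΦm k
    · refine Filter.Eventually.of_forall fun ω => ?_
      exact sum_first_passage_le
        (fun k : ℕ => B (τ * (k / (n + 1))) ω + d * (τ * (k / (n + 1)) : ℝ≥0)) m
        (φ := fun x => w ω * Φ x (B τ ω + d * τ)) (K := w ω * K)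
        (fun x => mul_le_mul_right (hΦK _ _) _) (n + 2)
    · filter_upwards [hB.cont, hB.eval_zero_ae_eq_zero, hne] with ω hc h0 hne
      refine tendsto_sum_first_passage (f := fun s : ℝ≥0 => B s ω + d * s) (by fun_prop)
        (by simpa [h0] using hm) τ (φ := fun x => w ω * Φ x (B τ ω + d * τ)) ?_
      exact ENNReal.Tendsto.const_mul (hΦc _ hne) (Or.inr ENNReal.ofReal_ne_top)
  have hl1 := hlim (fun _ y => G y) (hG.comp measurable_snd) (fun _ _ => hGK _)
    (fun _ _ => continuousAt_const)
  have hl2 := hlim (fun x y => G (2 * x - y)) (by fun_prop) (fun _ _ => hGK _) (fun y hy => by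
    have : ContinuousAt G (2 * m - y) := hGc _ fun h => hy (by linarith)
    exact ContinuousAt.comp' (g := G) (f := fun x => 2 * x - y) this (by fun_prop))
  refine tendsto_nhds_unique hl1 (hl2.congr fun n => ?_)
  rw [lintegral_finsetSum' _ fun k _ => hterm n (fun x y => G (2 * x - y)) (by fun_prop) k,
    lintegral_finsetSum' _ fun k _ => hterm n (fun x y => G y) (by fun_prop) k]
  refine Finset.sum_congr rfl fun k hk => ?_
  have hkτ : τ * (k / (n + 1)) ≤ τ := by
    refine mul_le_of_le_one_right zero_le ?_
    rw [div_le_one (by positivity)]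
    exact_mod_cast Nat.lt_succ_iff.1 (Finset.mem_range.1 hk)
  -- Capping the index at `k` keeps every sampled time in the past of the passage time; the event
  -- reads only indices up to `k`, so the cap changes nothing there.
  have := lintegral_reflect_increment hB.toIsPreBrownianReal d hkτ
    (u := fun i => τ * ((min i k : ℕ) / (n + 1))) (fun i => by gcongr; exact min_le_right _ _)
    (A := fun q => if m < q k + d * (τ * (k / (n + 1)) : ℝ≥0) ∧
          ∀ j < k, q j + d * (τ * (j / (n + 1)) : ℝ≥0) ≤ m then 1 else 0)
    (hpast n k) hG
  simp only [ite_mul, one_mul, zero_mul, min_self] at this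
  refine Eq.trans (lintegral_congr fun ω => ?_) (this.symm.trans (lintegral_congr fun ω => ?_))
  · have : (∀ j < k, B (τ * ((min j k : ℕ) / (n + 1))) ω + d * (τ * (j / (n + 1)) : ℝ≥0) ≤ m) ↔
        (∀ j < k, B (τ * (j / (n + 1))) ω + d * (τ * (j / (n + 1)) : ℝ≥0) ≤ m) :=
      forall₂_congr fun j hj => by rw [min_eq_left hj.le]
    simp only [this, hw]
  · have : (∀ j < k, B (τ * ((min j k : ℕ) / (n + 1))) ω + d * (τ * (j / (n + 1)) : ℝ≥0) ≤ m) ↔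
        (∀ j < k, B (τ * (j / (n + 1))) ω + d * (τ * (j / (n + 1)) : ℝ≥0) ≤ m) :=
      forall₂_congr fun j hj => by rw [min_eq_left hj.le]
    simp only [this, hw]

end SubordinatedBS

namespace SubordinatedBS

/-! ### The running maximum of a continuous path -/

/-- The maximum of a path on `[0, τ]`. -/
noncomputable def runMax (f : ℝ≥0 → ℝ) (τ : ℝ≥0) : ℝ := sSup (f '' Set.Icc 0 τ)

lemma bddAbove_image_Icc {f : ℝ≥0 → ℝ} (hf : Continuous f) (τ : ℝ≥0) :
    BddAbove (f '' Set.Icc 0 τ) :=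
  (isCompact_Icc.image hf).bddAbove

lemma lt_runMax_iff {f : ℝ≥0 → ℝ} (hf : Continuous f) {τ : ℝ≥0} {t : ℝ} :
    t < runMax f τ ↔ ∃ s ≤ τ, t < f s := by
  rw [runMax, lt_csSup_iff (bddAbove_image_Icc hf τ) ⟨f 0, 0, by simp, rfl⟩]
  simp

/-- The rational points of `[0, 1]`. -/
noncomputable def gridPoint (p : ℕ × ℕ) : ℝ≥0 := min (p.1 / (p.2 + 1)) 1

lemma gridPoint_le_one (p : ℕ × ℕ) : gridPoint p ≤ 1 := min_le_right _ _

lemma exists_grid_lt {f : ℝ≥0 → ℝ} (hf : Continuous f) {τ : ℝ≥0} {t : ℝ}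
    (h : ∃ s ≤ τ, t < f s) : ∃ p : ℕ × ℕ, t < f (τ * gridPoint p) := by
  classical
  rcases lt_or_ge t (f 0) with h0 | h0
  · exact ⟨(0, 0), by simpa [gridPoint] using h0⟩
  -- With `φ = 1` the sums tend to `1`, so some first-passage term is nonzero and exhibits a grid
  -- point above `t`.
  have := tendsto_sum_first_passage hf h0 τ (φ := fun _ => 1) continuousAt_const
  rw [if_pos h] at this
  obtain ⟨n, hn⟩ := (this.eventually_ne one_ne_zero).exists
  obtain ⟨k, hk, hne⟩ := Finset.exists_ne_zero_of_sum_ne_zero hn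
  refine ⟨(k, n), ?_⟩
  rw [gridPoint, min_eq_left]
  · by_contra hcon
    exact hne (if_neg fun h' => hcon h'.1)
  · rw [div_le_one (by positivity)]
    exact_mod_cast Nat.lt_succ_iff.1 (Finset.mem_range.1 hk)

/-- A supremum over a countable index set, scaled with `τ`: this makes the maximum measurable in
`ω`, and later jointly measurable in the expiry and the path. -/
lemma runMax_eq_iSup {f : ℝ≥0 → ℝ} (hf : Continuous f) (τ : ℝ≥0) :
    runMax f τ = ⨆ p : ℕ × ℕ, f (τ * gridPoint p) := by
  have hmem (p : ℕ × ℕ) : f (τ * gridPoint p) ∈ f '' Set.Icc 0 τ :=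
    ⟨_, ⟨zero_le, mul_le_of_le_one_right zero_le (gridPoint_le_one p)⟩, rfl⟩
  have hbdd : BddAbove (Set.range fun p : ℕ × ℕ => f (τ * gridPoint p)) :=
    (bddAbove_image_Icc hf τ).mono (Set.range_subset_iff.2 hmem)
  refine le_antisymm (le_of_forall_lt fun t ht => ?_)
    (ciSup_le fun p => le_csSup (bddAbove_image_Icc hf τ) (hmem p))
  obtain ⟨p, hp⟩ := exists_grid_lt hf ((lt_runMax_iff hf).1 ht)
  exact hp.trans_le (le_ciSup hbdd p)

/-- A continuous decreasing map exchanges supremum and infimum; this converts the minimum of the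
price into a running maximum. -/
lemma sInf_image_exp {f : ℝ≥0 → ℝ} (hf : Continuous f) (τ : ℝ≥0) {Z₀ σ : ℝ} (hZ : 0 < Z₀)
    (hσ : 0 < σ) : sInf ((fun t => Z₀ * Real.exp (-σ * f t)) '' Set.Icc 0 τ) =
      Z₀ * Real.exp (-σ * runMax f τ) := by
  have h : Antitone fun x : ℝ => Z₀ * Real.exp (-σ * x) := fun x y hxy => by
    have : -σ * y ≤ -σ * x := by nlinarith
    exact mul_le_mul_of_nonneg_left (Real.exp_le_exp.2 this) hZ.le
  have h2 := h.map_csSup_of_continuousAt (A := f '' Set.Icc 0 τ) (by fun_prop)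
    ⟨f 0, 0, by simp, rfl⟩ (bddAbove_image_Icc hf τ)
  rw [runMax, h2, Set.image_image]

/-! ### Gaussian tails -/

lemma Phi_eq (x : ℝ) : Phi x = (gaussianReal 0 1).real (Set.Iic x) := cdf_eq_real _ _

lemma Phi_nonneg (x : ℝ) : 0 ≤ Phi x := cdf_nonneg _ _

lemma Phi_le_one (x : ℝ) : Phi x ≤ 1 := cdf_le_one _ _

lemma ofReal_Phi (x : ℝ) : ENNReal.ofReal (Phi x) = gaussianReal 0 1 (Set.Iic x) := ofReal_cdf _ _

lemma gaussianReal_Iic (m x : ℝ) {v : ℝ≥0} (hv : v ≠ 0) :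
    gaussianReal m v (Set.Iic x) = ENNReal.ofReal (Phi ((x - m) / √v)) := by
  have hv' : (0 : ℝ) < √v := by positivity
  have h1 : gaussianReal m v = (gaussianReal 0 1).map (fun y => √v * y + m) := by
    have : (fun y : ℝ => √v * y + m) = (fun y => y + m) ∘ (fun y => √v * y) := rfl
    rw [this, ← Measure.map_map (by fun_prop) (by fun_prop), gaussianReal_map_const_mul,
      gaussianReal_map_add_const]
    congr 1
    · simp
    · ext; simp
  rw [ofReal_Phi, h1, Measure.map_apply (by fun_prop) measurableSet_Iic]
  congr 1
  ext y
  simp only [Set.mem_preimage, Set.mem_Iic]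
  rw [le_div_iff₀ hv', mul_comm, le_sub_iff_add_le]

lemma gaussianReal_Iio (m x : ℝ) {v : ℝ≥0} (hv : v ≠ 0) :
    gaussianReal m v (Set.Iio x) = ENNReal.ofReal (Phi ((x - m) / √v)) := by
  have := nullSingletonClass_gaussianReal (μ := m) hv
  rw [← gaussianReal_Iic m x hv]
  exact measure_congr Iio_ae_eq_Iic

lemma gaussianReal_Ioi (m x : ℝ) {v : ℝ≥0} (hv : v ≠ 0) :
    gaussianReal m v (Set.Ioi x) = ENNReal.ofReal (Phi ((m - x) / √v)) := by
  have h := gaussianReal_Iio (-m) (-x) hv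
  rw [← gaussianReal_map_neg, Measure.map_apply (by fun_prop) measurableSet_Iio] at h
  rw [show (m - x) / √v = (-x - -m) / √v by ring_nf, ← h]
  congr 1
  ext y
  simp

lemma Phi_neg (x : ℝ) : Phi (-x) = 1 - Phi x := by
  have h1 : ENNReal.ofReal (Phi (-x)) = gaussianReal 0 1 (Set.Ioi x) := by
    rw [gaussianReal_Ioi 0 x one_ne_zero]; simp
  rw [← Set.compl_Iic, prob_compl_eq_one_sub measurableSet_Iic, ← ofReal_Phi,
    ← ENNReal.ofReal_one, ← ENNReal.ofReal_sub _ (Phi_nonneg x)] at h1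
  exact (ENNReal.ofReal_eq_ofReal_iff (Phi_nonneg _) (sub_nonneg.2 (Phi_le_one x))).1 h1

lemma hasDerivAt_Phi (x : ℝ) : HasDerivAt Phi (gaussianPDFReal 0 1 x) x := by
  have hint := integrable_gaussianPDFReal 0 1
  have hcont : Continuous (gaussianPDFReal 0 1) := by
    unfold gaussianPDFReal; fun_prop
  have h : ∀ y, Phi y = Phi 0 + ∫ t in (0 : ℝ)..y, gaussianPDFReal 0 1 t := by
    intro y
    have hP (z : ℝ) : Phi z = ∫ t in Set.Iic z, gaussianPDFReal 0 1 t := by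
      rw [Phi_eq, Measure.real, gaussianReal_apply_eq_integral _ one_ne_zero,
        ENNReal.toReal_ofReal (integral_nonneg fun _ => gaussianPDFReal_nonneg _ _ _)]
    rw [hP, hP, ← intervalIntegral.integral_Iic_sub_Iic hint.integrableOn hint.integrableOn]
    ring
  have h2 : HasDerivAt (fun y => Phi 0 + ∫ t in (0 : ℝ)..y, gaussianPDFReal 0 1 t)
      (gaussianPDFReal 0 1 x) x :=
    (intervalIntegral.integral_hasDerivAt_right (hcont.intervalIntegrable _ _)
      hcont.stronglyMeasurable.stronglyMeasurableAtFilter hcont.continuousAt).const_add _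
  exact h2.congr_of_eventuallyEq (Filter.Eventually.of_forall h)

lemma continuous_Phi : Continuous Phi :=
  continuous_iff_continuousAt.2 fun x => (hasDerivAt_Phi x).continuousAt

/-- The Chernoff bound for the normal distribution function. -/
lemma Phi_le_exp (x l : ℝ) (hl : 0 ≤ l) : Phi x ≤ Real.exp (l * x + l ^ 2 / 2) := by
  have h := measure_le_le_exp_mul_mgf (μ := gaussianReal 0 1) (X := id) (t := -l) x (by linarith)
    (by simpa using integrable_exp_mul_gaussianReal (μ := 0) (v := 1) (-l))
  rw [mgf_id_gaussianReal, ← Real.exp_add] at h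
  rw [Phi_eq]
  refine h.trans (le_of_eq ?_)
  congr 1
  simp

lemma Phi_zero : Phi 0 = 1 / 2 := by
  have := Phi_neg 0
  rw [neg_zero] at this
  linarith

end SubordinatedBS

namespace SubordinatedBS

/-! ### The law of the running maximum of a Brownian motion with drift -/

variable {Ω : Type*} [MeasurableSpace Ω] {P : Measure Ω} {B : ℝ≥0 → Ω → ℝ}

lemma aemeasurable_runMax (hB : IsBrownianReal B P) (d : ℝ) (τ : ℝ≥0) :
    AEMeasurable (fun ω => runMax (fun s => B s ω + d * s) τ) P := by
  have h : AEMeasurable (fun ω => ⨆ p : ℕ × ℕ,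
      (B (τ * gridPoint p) ω + d * (τ * gridPoint p : ℝ≥0))) P :=
    AEMeasurable.iSup fun p => (hB.aemeasurable _).add_const _
  refine h.congr ?_
  filter_upwards [hB.cont] with ω hω
  exact (runMax_eq_iSup (f := fun s : ℝ≥0 => B s ω + d * s) (by fun_prop) τ).symm

lemma nullMeasurableSet_exists_lt (hB : IsBrownianReal B P) (d : ℝ) (τ : ℝ≥0) (m : ℝ) :
    NullMeasurableSet {ω | ∃ s ≤ τ, m < B s ω + d * s} P := by
  have h := (aemeasurable_runMax hB d τ).nullMeasurableSet_preimage (measurableSet_Ioi (a := m))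
  refine h.congr ?_
  filter_upwards [hB.cont] with ω hω
  exact propext (lt_runMax_iff (f := fun s : ℝ≥0 => B s ω + d * s) (by fun_prop))

lemma ae_ne_of_isBrownianReal (hB : IsBrownianReal B P) {τ : ℝ≥0} (hτ : 0 < τ) (m : ℝ) :
    ∀ᵐ ω ∂P, B τ ω ≠ m := by
  have hlaw := hB.hasLaw_eval τ
  have : ∀ᵐ x ∂(P.map (B τ)), x ≠ m := by
    rw [hlaw.map_eq]
    have := nullSingletonClass_gaussianReal (μ := 0) hτ.ne'
    rw [ae_iff]
    simp
  exact ae_of_ae_map hlaw.aemeasurable this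

open Classical in
-- Monotone convergence along the truncations `min G j`, which are bounded and keep the continuity
-- off `m`, removes the bound on `G`.
lemma lintegral_reflection_of_measurable [IsProbabilityMeasure P] (hB : IsBrownianReal B P) (d : ℝ)
    {τ : ℝ≥0} (hτ : 0 < τ) {m : ℝ} (hm : 0 ≤ m) {G : ℝ → ℝ≥0∞} (hG : Measurable G)
    (hGc : ∀ x ≠ m, ContinuousAt G x) :
    ∫⁻ ω, (if ∃ s ≤ τ, m < B s ω + d * s then
      ENNReal.ofReal (Real.exp (-d * (B τ ω + d * τ))) * G (B τ ω + d * τ) else 0) ∂P =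
    ∫⁻ ω, (if ∃ s ≤ τ, m < B s ω + d * s then
      ENNReal.ofReal (Real.exp (-d * (B τ ω + d * τ))) * G (2 * m - (B τ ω + d * τ))
        else 0) ∂P := by
  have hBm : ∀ t, AEMeasurable (B t) P := hB.aemeasurable
  have key (h : Ω → ℝ) (hh : AEMeasurable h P) :
      ∫⁻ ω, (if ∃ s ≤ τ, m < B s ω + d * s then
        ENNReal.ofReal (Real.exp (-d * (B τ ω + d * τ))) * G (h ω) else 0) ∂P =
      ⨆ j : ℕ, ∫⁻ ω, (if ∃ s ≤ τ, m < B s ω + d * s then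
        ENNReal.ofReal (Real.exp (-d * (B τ ω + d * τ))) * min (G (h ω)) j else 0) ∂P := by
    rw [← lintegral_iSup']
    · refine lintegral_congr fun ω => ?_
      split_ifs
      · rw [← ENNReal.mul_iSup]
        congr 1
        have : ⨆ j : ℕ, min (G (h ω)) (j : ℝ≥0∞) = min (G (h ω)) (⨆ j : ℕ, (j : ℝ≥0∞)) :=
          (inf_iSup_eq _ _).symm
        rw [this, ENNReal.iSup_natCast, min_eq_left le_top]
      · simp
    · intro j
      have h1 : AEMeasurable (fun ω => ENNReal.ofReal (Real.exp (-d * (B τ ω + d * τ))) *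
        min (G (h ω)) j) P := by
        have := hG.comp_aemeasurable hh
        have : AEMeasurable (fun ω => G (h ω)) P := this
        fun_prop
      refine (h1.indicator₀ (nullMeasurableSet_exists_lt hB d τ m)).congr
        (Filter.Eventually.of_forall fun ω => ?_)
      simp [Set.indicator_apply]
    · refine Filter.Eventually.of_forall fun ω i j hij => ?_
      dsimp only
      split_ifs
      · gcongr
      · exact le_rfl
  rw [key _ ((hBm τ).add_const _), key (fun ω => 2 * m - (B τ ω + d * τ)) (by fun_prop)]
  refine iSup_congr fun j => ?_
  exact lintegral_reflection hB d hτ hm (G := fun x => min (G x) j) (by fun_prop)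
    (ENNReal.natCast_ne_top j) (fun x => min_le_right _ _)
    (fun x hx => (hGc x hx).min continuousAt_const)

/-- The tilt by `c` moves the law of `B τ` to N(cτ, τ), leaving a Gaussian tail. -/
lemma lintegral_exp_brownian_Ioi (hB : IsPreBrownianReal B P) (c k x : ℝ) {τ : ℝ≥0}
    (hτ : 0 < τ) :
    ∫⁻ ω, ENNReal.ofReal (Real.exp (c * B τ ω + k)) * (Set.Ioi x).indicator 1 (B τ ω) ∂P =
      ENNReal.ofReal (Real.exp (c ^ 2 * τ / 2 + k) * Phi ((c * τ - x) / √τ)) := by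
  have h1 := (hB.hasLaw_eval τ).lintegral_comp (f := fun y => ENNReal.ofReal (Real.exp (c * y + k)) *
    (Set.Ioi x).indicator 1 y)
    (by have : Measurable ((Set.Ioi x).indicator (1 : ℝ → ℝ≥0∞)) :=
          measurable_one.indicator measurableSet_Ioi
        fun_prop)
  rw [h1]
  have h2 := lintegral_exp_mul_gaussianReal 0 c τ
    (h := fun y => ENNReal.ofReal (Real.exp k) * (Set.Ioi x).indicator 1 y)
    (by have : Measurable ((Set.Ioi x).indicator (1 : ℝ → ℝ≥0∞)) :=
          measurable_one.indicator measurableSet_Ioi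
        fun_prop)
  simp only [Real.exp_add, ENNReal.ofReal_mul (Real.exp_pos _).le, mul_assoc]
  simp only [Real.exp_add, ENNReal.ofReal_mul (Real.exp_pos _).le, mul_assoc] at h2
  rw [h2, lintegral_const_mul _ (measurable_one.indicator measurableSet_Ioi),
    lintegral_indicator_one measurableSet_Ioi, gaussianReal_Ioi _ _ hτ.ne']
  simp only [mul_zero, zero_add, Real.exp_zero, ENNReal.ofReal_one, one_mul]
  rw [mul_comm (c ^ 2)]

open Classical in
/-- The law of the running maximum under the exponentially tilted measure. -/
theorem lintegral_exp_exists_lt [IsProbabilityMeasure P] (hB : IsBrownianReal B P) (d c : ℝ)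
    {τ : ℝ≥0} (hτ : 0 < τ) {m : ℝ} (hm : 0 ≤ m) :
    ∫⁻ ω, (if ∃ s ≤ τ, m < B s ω + d * s then
      ENNReal.ofReal (Real.exp (c * B τ ω - c ^ 2 / 2 * τ)) else 0) ∂P =
    ENNReal.ofReal (Phi (((d + c) * τ - m) / √τ) +
      Real.exp (2 * (d + c) * m) * Phi ((-m - (d + c) * τ) / √τ)) := by
  have hBm : ∀ t, AEMeasurable (B t) P := hB.aemeasurable
  -- Chosen so that on paths ending below `m` the weight times `G` of the reflected endpoint is
  -- exactly `exp(c B τ - c² τ / 2)`.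
  set G : ℝ → ℝ≥0∞ := (Set.Ioi m).indicator fun x =>
    ENNReal.ofReal (Real.exp ((d + c) * (2 * m - x) - c * d * τ - c ^ 2 / 2 * τ)) with hGdef
  have hG : Measurable G := Measurable.indicator (by fun_prop) measurableSet_Ioi
  have hGc : ∀ x ≠ m, ContinuousAt G x := by
    intro x hx
    rcases lt_or_gt_of_ne hx with h | h
    · refine (continuousAt_const (y := (0 : ℝ≥0∞))).congr ?_
      filter_upwards [Iio_mem_nhds h] with y hy
      rw [hGdef, Set.indicator_of_notMem]
      simpa using hy.le
    · have : ContinuousAt (fun x => ENNReal.ofReal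
          (Real.exp ((d + c) * (2 * m - x) - c * d * τ - c ^ 2 / 2 * τ))) x := by
        apply Continuous.continuousAt
        exact ENNReal.continuous_ofReal.comp (by fun_prop)
      refine this.congr ?_
      filter_upwards [Ioi_mem_nhds h] with y hy
      rw [hGdef, Set.indicator_of_mem hy]
  have hGin : ∀ x, m < x → G x =
      ENNReal.ofReal (Real.exp ((d + c) * (2 * m - x) - c * d * τ - c ^ 2 / 2 * τ)) := fun x hx =>
    Set.indicator_of_mem (s := Set.Ioi m) hx _
  have hGout : ∀ x, x ≤ m → G x = 0 := fun x hx =>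
    Set.indicator_of_notMem (s := Set.Ioi m) (not_lt.2 hx) _
  have hIin : ∀ x, m < x + d * τ → (Set.Ioi (m - d * τ)).indicator (1 : ℝ → ℝ≥0∞) x = 1 :=
    fun x hx => Set.indicator_of_mem (s := Set.Ioi (m - d * τ)) (sub_lt_iff_lt_add.2 hx) _
  have hIout : ∀ x, x + d * τ ≤ m → (Set.Ioi (m - d * τ)).indicator (1 : ℝ → ℝ≥0∞) x = 0 :=
    fun x hx => Set.indicator_of_notMem (s := Set.Ioi (m - d * τ)) (not_lt.2 (le_sub_iff_add_le.2 hx)) _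
  have hrefl := lintegral_reflection_of_measurable hB d hτ hm hG hGc
  -- A path ending above `m` has crossed `m`; paths ending below `m` are expressed through `G`;
  -- ending at `m` has probability zero.
  have hsplit : ∫⁻ ω, (if ∃ s ≤ τ, m < B s ω + d * s then
      ENNReal.ofReal (Real.exp (c * B τ ω - c ^ 2 / 2 * τ)) else 0) ∂P =
      ∫⁻ ω, ENNReal.ofReal (Real.exp (c * B τ ω + -(c ^ 2 / 2 * τ))) *
        (Set.Ioi (m - d * τ)).indicator 1 (B τ ω) ∂P +
      ∫⁻ ω, (if ∃ s ≤ τ, m < B s ω + d * s then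
      ENNReal.ofReal (Real.exp (-d * (B τ ω + d * τ))) * G (2 * m - (B τ ω + d * τ))
        else 0) ∂P := by
    rw [← lintegral_add_left']
    · refine lintegral_congr_ae ?_
      filter_upwards [ae_ne_of_isBrownianReal hB hτ (m - d * τ)] with ω hω
      by_cases h1 : m < B τ ω + d * τ
      · have h2 : ∃ s ≤ τ, m < B s ω + d * s := ⟨τ, le_rfl, h1⟩
        rw [if_pos h2, if_pos h2, hIin _ h1, hGout _ (by linarith)]
        simp [sub_eq_add_neg]
      · rw [hIout _ (not_lt.1 h1), mul_zero, zero_add]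
        split_ifs
        · rw [hGin, ← ENNReal.ofReal_mul (Real.exp_pos _).le, ← Real.exp_add]
          · congr 2
            ring
          · rcases lt_or_eq_of_le (not_lt.1 h1) with h | h
            · linarith
            · exact absurd (by linarith) hω
        · rfl
    · have h1 : Measurable ((Set.Ioi (m - d * τ)).indicator (1 : ℝ → ℝ≥0∞)) :=
        measurable_one.indicator measurableSet_Ioi
      have h2 : AEMeasurable (fun ω => (Set.Ioi (m - d * τ)).indicator (1 : ℝ → ℝ≥0∞) (B τ ω)) P :=
        h1.comp_aemeasurable (hBm τ)
      fun_prop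
  -- After reflection `G` is supported on endpoints above `m`, where the crossing condition holds
  -- automatically.
  have hsecond : ∫⁻ ω, (if ∃ s ≤ τ, m < B s ω + d * s then
      ENNReal.ofReal (Real.exp (-d * (B τ ω + d * τ))) * G (B τ ω + d * τ) else 0) ∂P =
      ∫⁻ ω, ENNReal.ofReal (Real.exp (-(2 * d + c) * B τ ω + ((d + c) * 2 * m
        - 2 * d * (d + c) * τ - c ^ 2 / 2 * τ))) *
        (Set.Ioi (m - d * τ)).indicator 1 (B τ ω) ∂P := by
    refine lintegral_congr fun ω => ?_
    by_cases h1 : m < B τ ω + d * τ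
    · have h2 : ∃ s ≤ τ, m < B s ω + d * s := ⟨τ, le_rfl, h1⟩
      rw [if_pos h2, hGin _ h1, hIin _ h1, ← ENNReal.ofReal_mul (Real.exp_pos _).le,
        ← Real.exp_add, mul_one]
      congr 2
      ring
    · rw [hGout _ (not_lt.1 h1), hIout _ (not_lt.1 h1)]
      simp
  rw [hsplit, ← hrefl, hsecond, lintegral_exp_brownian_Ioi hB.toIsPreBrownianReal _ _ _ hτ,
    lintegral_exp_brownian_Ioi hB.toIsPreBrownianReal _ _ _ hτ, ← ENNReal.ofReal_add
    (mul_nonneg (Real.exp_pos _).le (Phi_nonneg _)) (mul_nonneg (Real.exp_pos _).le (Phi_nonneg _))]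
  congr 2
  · rw [show c ^ 2 * (τ : ℝ) / 2 + -(c ^ 2 / 2 * τ) = 0 by ring, Real.exp_zero, one_mul]
    congr 2
    ring
  · congr 2
    · ring
    · congr 1
      ring

end SubordinatedBS

namespace SubordinatedBS

/-! ### The classical price -/

lemma gaussianPDFReal_sub_std (z a : ℝ) :
    gaussianPDFReal 0 1 (z - a) = gaussianPDFReal 0 1 z * Real.exp (a * z - a ^ 2 / 2) := by
  simp only [gaussianPDFReal]
  rw [mul_assoc (√(2 * Real.pi * (1 : ℝ≥0)))⁻¹, ← Real.exp_add]
  congr 2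
  simp
  ring

lemma tendsto_exp_mul_Phi (κ c : ℝ) {s : ℝ} (hs : 0 < s) (a : ℝ) :
    Filter.Tendsto (fun t => Real.exp (-κ * t) * Phi ((c - t) / s - a)) Filter.atTop (nhds 0) := by
  -- With this Chernoff parameter the tail contributes `exp(-(|κ| + 1) t)`, which beats `exp(-κ t)`
  -- by `exp(-t)`.
  set l : ℝ := s * (|κ| + 1) with hl
  have hbound : ∀ t : ℝ, 0 ≤ t → Real.exp (-κ * t) * Phi ((c - t) / s - a) ≤
      Real.exp (l * (c / s - a) + l ^ 2 / 2) * Real.exp (-t) := by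
    intro t ht
    have h1 := Phi_le_exp ((c - t) / s - a) l (by positivity)
    calc _ ≤ Real.exp (-κ * t) * Real.exp (l * ((c - t) / s - a) + l ^ 2 / 2) := by gcongr
      _ = Real.exp (l * (c / s - a) + l ^ 2 / 2) * Real.exp (-κ * t - (|κ| + 1) * t) := by
        rw [← Real.exp_add, ← Real.exp_add]
        congr 1
        rw [hl]
        field_simp
        ring
      _ ≤ _ := by
        gcongr
        nlinarith [neg_abs_le κ]
  refine squeeze_zero' (Filter.Eventually.of_forall fun t =>
    mul_nonneg (Real.exp_pos _).le (Phi_nonneg _))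
    ((Filter.eventually_ge_atTop 0).mono hbound) ?_
  simpa using (Real.tendsto_exp_neg_atTop_nhds_zero.const_mul
    (Real.exp (l * (c / s - a) + l ^ 2 / 2)))

/-- Integration by parts leaves an exponential times a Gaussian density; completing the square turns
it into the density shifted by `κ s`, hence an explicit primitive. -/
lemma integral_exp_mul_Phi {κ : ℝ} (hκ : κ ≠ 0) (c : ℝ) {s : ℝ} (hs : 0 < s) :
    IntegrableOn (fun t => Real.exp (-κ * t) * Phi ((c - t) / s)) (Set.Ioi 0) ∧
    ∫ t in Set.Ioi 0, Real.exp (-κ * t) * Phi ((c - t) / s) =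
      (Phi (c / s) - Real.exp (κ ^ 2 * s ^ 2 / 2 - κ * c) * Phi (c / s - κ * s)) / κ := by
  -- The idle `- 0` and `-0 * t` give both pieces the shape whose limit at infinity is already
  -- known.
  set F : ℝ → ℝ := fun t => (-(Real.exp (-κ * t) * Phi ((c - t) / s - 0)) +
    Real.exp (κ ^ 2 * s ^ 2 / 2 - κ * c) * (Real.exp (-0 * t) * Phi ((c - t) / s - κ * s))) / κ
    with hF
  have hderiv : ∀ t : ℝ, HasDerivAt F (Real.exp (-κ * t) * Phi ((c - t) / s)) t := by
    intro t
    have h0 : ∀ a : ℝ, HasDerivAt (fun t => (c - t) / s - a) (-1 / s) t := fun a =>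
      (((hasDerivAt_id t).const_sub c).div_const s).sub_const a
    have h1 : ∀ a : ℝ, HasDerivAt (fun t => Phi ((c - t) / s - a))
        (gaussianPDFReal 0 1 ((c - t) / s - a) * (-1 / s)) t := fun a =>
      (hasDerivAt_Phi _).comp t (h0 a)
    have h2 : ∀ k : ℝ, HasDerivAt (fun t => Real.exp (-k * t)) (Real.exp (-k * t) * (-k)) t := by
      intro k
      simpa using ((hasDerivAt_id t).const_mul (-k)).exp
    have h3 := ((((h2 κ).mul (h1 0)).neg).add
      (((h2 0).mul (h1 (κ * s))).const_mul (Real.exp (κ ^ 2 * s ^ 2 / 2 - κ * c)))).div_const κ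
    refine HasDerivAt.congr_deriv h3 ?_
    rw [gaussianPDFReal_sub_std _ (κ * s)]
    have e1 : Real.exp (κ ^ 2 * s ^ 2 / 2 - κ * c) *
        Real.exp (κ * s * ((c - t) / s) - (κ * s) ^ 2 / 2) = Real.exp (-κ * t) := by
      rw [← Real.exp_add]
      congr 1
      field_simp
      ring
    rw [sub_zero, div_eq_iff hκ]
    simp only [neg_zero, zero_mul, Real.exp_zero, mul_zero, one_mul, zero_add]
    linear_combination -(gaussianPDFReal 0 1 ((c - t) / s) * (1 / s)) * e1
  have hlim : Filter.Tendsto F Filter.atTop (nhds 0) := by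
    have := ((tendsto_exp_mul_Phi κ c hs 0).neg.add
      ((tendsto_exp_mul_Phi 0 c hs (κ * s)).const_mul
        (Real.exp (κ ^ 2 * s ^ 2 / 2 - κ * c)))).div_const κ
    simpa [hF] using this
  have hpos : ∀ t ∈ Set.Ioi (0 : ℝ), 0 ≤ Real.exp (-κ * t) * Phi ((c - t) / s) := fun t _ =>
    mul_nonneg (Real.exp_pos _).le (Phi_nonneg _)
  refine ⟨integrableOn_Ioi_deriv_of_nonneg' (fun t _ => hderiv t) hpos hlim, ?_⟩
  rw [integral_Ioi_of_hasDerivAt_of_nonneg' (fun t _ => hderiv t) hpos hlim]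
  simp [hF]
  ring

variable {Ω : Type*} [MeasurableSpace Ω] {P : Measure Ω} {B : ℝ≥0 → Ω → ℝ}

lemma integral_exp_brownian (hB : IsPreBrownianReal B P) (c k : ℝ) (τ : ℝ≥0) :
    Integrable (fun ω => Real.exp (c * B τ ω + k)) P ∧
      ∫ ω, Real.exp (c * B τ ω + k) ∂P = Real.exp (c ^ 2 * τ / 2 + k) := by
  have hlaw := hB.hasLaw_eval τ
  have hi : Integrable (fun ω => Real.exp (c * B τ ω)) P := by
    have h := integrable_exp_mul_gaussianReal (μ := 0) (v := τ) c
    rw [← hlaw.map_eq] at h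
    exact h.comp_aemeasurable hlaw.aemeasurable
  have he : ∫ ω, Real.exp (c * B τ ω) ∂P = Real.exp (c ^ 2 * τ / 2) := by
    have := mgf_gaussianReal hlaw.map_eq c
    rw [mgf] at this
    rw [this]
    congr 1
    ring
  simp only [Real.exp_add]
  exact ⟨hi.mul_const _, by rw [integral_mul_const, he]⟩

/-- The density of the martingale measure for the constant time `τ`. -/
noncomputable def girsanovDensity (c : ℝ) (B : ℝ≥0 → Ω → ℝ) (τ : ℝ≥0) (ω : Ω) : ℝ :=
  Real.exp (-c * B τ ω - c ^ 2 / 2 * τ)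

lemma integral_girsanovDensity (hB : IsPreBrownianReal B P) (c : ℝ) (τ : ℝ≥0) :
    Integrable (girsanovDensity c B τ) P ∧ ∫ ω, girsanovDensity c B τ ω ∂P = 1 := by
  have := integral_exp_brownian hB (-c) (-(c ^ 2 / 2 * τ)) τ
  refine ⟨this.1, this.2.trans ?_⟩
  rw [Real.exp_eq_one_iff]
  ring

/-- The expectation of the exponential of the minimum of the driving drifted Brownian motion. -/
lemma integral_exp_neg_runMax [IsProbabilityMeasure P] (hB : IsBrownianReal B P)
    {r μ σ : ℝ} (hr : r ≠ 0) (hσ : 0 < σ) {τ : ℝ≥0} (hτ : 0 < τ) :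
    Integrable (fun ω => girsanovDensity (gammaParam r μ σ) B τ ω *
      Real.exp (-σ * runMax (fun s => -B s ω + -(μ / σ) * s) τ)) P ∧
    ∫ ω, girsanovDensity (gammaParam r μ σ) B τ ω *
      Real.exp (-σ * runMax (fun s => -B s ω + -(μ / σ) * s) τ) ∂P =
      (1 - σ ^ 2 / (2 * r)) * Phi ((r / σ - σ / 2) * √τ) +
      (1 + σ ^ 2 / (2 * r)) * Real.exp (r * τ) * (1 - Phi ((r / σ + σ / 2) * √τ)) := by
  classical
  set γ := gammaParam r μ σ with hγ
  set D := girsanovDensity γ B τ with hD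
  set X : Ω → ℝ := fun ω => runMax (fun s => -B s ω + -(μ / σ) * s) τ with hX
  obtain ⟨hDi, hD1⟩ := integral_girsanovDensity hB.toIsPreBrownianReal γ τ
  have hDpos : ∀ ω, 0 ≤ D ω := fun ω => (Real.exp_pos _).le
  have hXm : AEMeasurable X P := aemeasurable_runMax hB.neg (-(μ / σ)) τ
  have hXpos : ∀ᵐ ω ∂P, 0 ≤ X ω := by
    filter_upwards [hB.cont, hB.eval_zero_ae_eq_zero] with ω hc h0
    refine le_csSup (bddAbove_image_Icc (f := fun s : ℝ≥0 => -B s ω + -(μ / σ) * s)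
      (by fun_prop) τ) ⟨0, by simp, by simp [h0]⟩
  set Q : Measure Ω := P.withDensity fun ω => ENNReal.ofReal (D ω) with hQ
  have hQac : Q ≪ P := withDensity_absolutelyContinuous _ _
  have hQprob : IsProbabilityMeasure Q := by
    refine ⟨?_⟩
    rw [hQ, withDensity_apply _ MeasurableSet.univ, Measure.restrict_univ,
      ← ofReal_integral_eq_lintegral_ofReal hDi (Filter.Eventually.of_forall hDpos), hD1,
      ENNReal.ofReal_one]
  have hcont : ∀ᵐ ω ∂P, Continuous fun s : ℝ≥0 => -B s ω + -(μ / σ) * s := by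
    filter_upwards [hB.cont] with ω hc
    fun_prop
  -- The drift of `-B s - (μ/σ) s` under `Q`.
  set b : ℝ := σ / 2 - r / σ with hb
  have hbγ : -(μ / σ) + γ = b := by
    rw [hγ, gammaParam, hb]
    field_simp
    ring
  -- The tail `Q(X > t)` given by the reflection principle.
  set H : ℝ → ℝ := fun t => Phi ((b * τ - t) / √τ) +
      Real.exp (2 * b * t) * Phi ((-t - b * τ) / √τ) with hH
  have hQX : ∀ t ∈ Set.Ioi (0 : ℝ), Q {ω | t < X ω} = ENNReal.ofReal (H t) := by
    intro t ht
    have h1 := lintegral_exp_exists_lt hB.neg (-(μ / σ)) γ hτ (m := t) (le_of_lt ht)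
    rw [hbγ] at h1
    have hset : NullMeasurableSet {ω | t < X ω} P := nullMeasurableSet_lt aemeasurable_const hXm
    rw [hH, ← h1, hQ, withDensity_apply', ← lintegral_indicator₀ hset]
    refine lintegral_congr_ae ?_
    filter_upwards [hcont] with ω hω
    have h2 := lt_runMax_iff hω (τ := τ) (t := t)
    have h3 : ω ∈ {ω | t < X ω} ↔ ∃ s ≤ τ, t < (-B) s ω + -(μ / σ) * s := h2
    rw [Set.indicator_apply]
    simp only [h3]
    split_ifs
    · simp only [hD, girsanovDensity, Pi.neg_apply]
      congr 2
      ring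
    · rfl
  have hs : (0 : ℝ) < √τ := by positivity
  have hsτ : √(τ : ℝ) ^ 2 = τ := Real.sq_sqrt τ.2
  have hκ : 2 * r / σ ≠ 0 := by positivity
  obtain ⟨hi1, he1⟩ := integral_exp_mul_Phi hσ.ne' (b * τ) hs
  obtain ⟨hi2, he2⟩ := integral_exp_mul_Phi hκ (-(b * τ)) hs
  -- Because `2 b - σ = -2 r / σ`, the second term is again of the form exponential times `Phi`, now
  -- with rate `2 r / σ`, nonzero since `r ≠ 0`.
  have hHg : ∀ t, H t * (σ * Real.exp (-σ * t)) = σ * (Real.exp (-σ * t) * Phi ((b * τ - t) / √τ))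
      + σ * (Real.exp (-(2 * r / σ) * t) * Phi ((-(b * τ) - t) / √τ)) := by
    intro t
    have h1 : Real.exp (2 * b * t) * Real.exp (-σ * t) = Real.exp (-(2 * r / σ) * t) := by
      rw [← Real.exp_add]
      congr 1
      rw [hb]
      field_simp
      ring
    rw [← h1, ← show -t - b * τ = -(b * τ) - t by ring]
    simp only [hH]
    ring
  have hHi : IntegrableOn (fun t => H t * (σ * Real.exp (-σ * t))) (Set.Ioi 0) := by
    simp only [hHg]
    exact (hi1.const_mul σ).add (hi2.const_mul σ)
  have hHe : ∫ t in Set.Ioi 0, H t * (σ * Real.exp (-σ * t)) =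
      1 - ((1 - σ ^ 2 / (2 * r)) * Phi ((r / σ - σ / 2) * √τ) +
      (1 + σ ^ 2 / (2 * r)) * Real.exp (r * τ) * (1 - Phi ((r / σ + σ / 2) * √τ))) := by
    simp only [hHg]
    rw [integral_add (hi1.const_mul σ) (hi2.const_mul σ), integral_const_mul, integral_const_mul,
      he1, he2, hsτ]
    have e1 : σ ^ 2 * τ / 2 - σ * (b * τ) = r * τ := by
      rw [hb]; field_simp; ring
    have e2 : (2 * r / σ) ^ 2 * τ / 2 - 2 * r / σ * (-(b * τ)) = r * τ := by
      rw [hb]; field_simp; ring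
    have hst : (τ : ℝ) / √τ = √τ := Real.div_sqrt
    have e3 : b * τ / √τ = -((r / σ - σ / 2) * √τ) := by
      rw [mul_div_assoc, hst, hb]; ring
    have e4 : -(b * τ) / √τ = (r / σ - σ / 2) * √τ := by
      rw [neg_div, e3, neg_neg]
    have e5 : b * τ / √τ - σ * √τ = -((r / σ + σ / 2) * √τ) := by
      rw [e3]; ring
    have e6 : -(b * τ) / √τ - 2 * r / σ * √τ = -((r / σ + σ / 2) * √τ) := by
      rw [e4]; ring
    rw [e1, e2, e5, e6, e3, e4, Phi_neg, Phi_neg]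
    field_simp
    ring
  -- Layer-cake formula for `1 - exp(-σ X)`, the integral of `σ exp(-σ t)` over `[0, X]`.
  have hlayer := lintegral_comp_eq_lintegral_meas_lt_mul Q (f := X)
    (g := fun t => σ * Real.exp (-σ * t)) (hQac hXpos) (hXm.mono_ac hQac)
    (fun t _ => (by fun_prop : Continuous fun t : ℝ => σ * Real.exp (-σ * t)).intervalIntegrable _ _)
    (Filter.Eventually.of_forall fun t => by positivity)
  have hprim : ∀ x : ℝ, ∫ t in (0 : ℝ)..x, σ * Real.exp (-σ * t) = 1 - Real.exp (-σ * x) := by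
    intro x
    rw [intervalIntegral.integral_eq_sub_of_hasDerivAt (f := fun t => -Real.exp (-σ * t))]
    · simp; ring
    · intro t _
      have := ((hasDerivAt_id t).const_mul (-σ)).exp.neg
      refine HasDerivAt.congr_deriv this ?_
      simp [mul_comm]
    · exact (by fun_prop : Continuous fun t : ℝ => σ * Real.exp (-σ * t)).intervalIntegrable _ _
  have hexpX : ∀ᵐ ω ∂Q, 0 ≤ 1 - Real.exp (-σ * X ω) := by
    filter_upwards [hQac hXpos] with ω hω
    rw [sub_nonneg, Real.exp_le_one_iff]
    nlinarith
  have hXQ : AEMeasurable X Q := hXm.mono_ac hQac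
  have hint1 : Integrable (fun ω => 1 - Real.exp (-σ * X ω)) Q := by
    refine Integrable.of_bound (C := 1) (by fun_prop) ?_
    filter_upwards [hexpX] with ω hω
    rw [Real.norm_of_nonneg hω]
    linarith [Real.exp_pos (-σ * X ω)]
  have hint2 : Integrable (fun ω => Real.exp (-σ * X ω)) Q := by
    refine ((integrable_const (1 : ℝ)).sub hint1).congr (Filter.Eventually.of_forall fun ω => ?_)
    simp
  have hval : ∫ ω, Real.exp (-σ * X ω) ∂Q = 1 - ∫ t in Set.Ioi 0, H t * (σ * Real.exp (-σ * t)) := by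
    have hHpos : ∀ t, 0 ≤ H t * (σ * Real.exp (-σ * t)) := fun t =>
      mul_nonneg (add_nonneg (Phi_nonneg _) (mul_nonneg (Real.exp_pos _).le (Phi_nonneg _)))
        (by positivity)
    have h1 : ∫ ω, (1 - Real.exp (-σ * X ω)) ∂Q = ∫ t in Set.Ioi 0, H t * (σ * Real.exp (-σ * t)) := by
      rw [integral_eq_lintegral_of_nonneg_ae hexpX hint1.aestronglyMeasurable,
        integral_eq_lintegral_of_nonneg_ae (Filter.Eventually.of_forall hHpos)
          hHi.aestronglyMeasurable]
      congr 1
      simp only [hprim] at hlayer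
      rw [hlayer]
      refine setLIntegral_congr_fun measurableSet_Ioi fun t ht => ?_
      rw [hQX t ht, ← ENNReal.ofReal_mul (add_nonneg (Phi_nonneg _)
        (mul_nonneg (Real.exp_pos _).le (Phi_nonneg _)))]
    rw [← h1, integral_sub (integrable_const _) hint2]
    simp
  have hDm : AEMeasurable D P := hDi.aemeasurable
  have hDm' : AEMeasurable (fun ω => ENNReal.ofReal (D ω)) P := hDm.ennreal_ofReal
  constructor
  · have := (integrable_withDensity_iff_integrable_smul₀' hDm'
      (Filter.Eventually.of_forall fun ω => ENNReal.ofReal_lt_top)).1 hint2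
    simpa only [ENNReal.toReal_ofReal (hDpos _), smul_eq_mul] using this
  · have := integral_withDensity_eq_integral_toReal_smul₀ hDm'
      (Filter.Eventually.of_forall fun ω => ENNReal.ofReal_lt_top) (fun ω => Real.exp (-σ * X ω))
    simp only [ENNReal.toReal_ofReal (hDpos _), smul_eq_mul] at this
    rw [← this, hval, hHe]
    ring

end SubordinatedBS

namespace SubordinatedBS

variable {Ω : Type*} {mΩ : MeasurableSpace Ω} {P : Measure Ω} {B : ℝ≥0 → Ω → ℝ}

lemma runMax_zero (f : ℝ≥0 → ℝ) : runMax f 0 = f 0 := by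
  simp [runMax]

lemma integral_exp_neg_runMax_zero [IsProbabilityMeasure P] (hB : IsBrownianReal B P)
    (r μ σ : ℝ) :
    Integrable (fun ω => girsanovDensity (gammaParam r μ σ) B 0 ω *
      Real.exp (-σ * runMax (fun s => -B s ω + -(μ / σ) * s) 0)) P ∧
    ∫ ω, girsanovDensity (gammaParam r μ σ) B 0 ω *
      Real.exp (-σ * runMax (fun s => -B s ω + -(μ / σ) * s) 0) ∂P = 1 := by
  have h : (fun ω => girsanovDensity (gammaParam r μ σ) B 0 ω *
      Real.exp (-σ * runMax (fun s => -B s ω + -(μ / σ) * s) 0)) =ᵐ[P] fun _ => (1 : ℝ) := by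
    filter_upwards [hB.eval_zero_ae_eq_zero] with ω h0
    simp [girsanovDensity, runMax_zero, h0]
  exact ⟨(integrable_const _).congr h.symm, by rw [integral_congr_ae h]; simp⟩

lemma classicalDiscountedPayoff_eq {Z₀ r μ σ : ℝ} (hZ₀ : 0 < Z₀) (hσ : 0 < σ) {ω : Ω}
    (hω : Continuous fun t => B t ω) (τ : ℝ≥0) :
    classicalDiscountedPayoff Z₀ r μ σ B τ ω =
      Real.exp (-(r * τ)) * (Z₀ * Real.exp (μ * τ + σ * B τ ω) -
        Z₀ * Real.exp (-σ * runMax (fun s => -B s ω + -(μ / σ) * s) τ)) := by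
  rw [← sInf_image_exp (f := fun s : ℝ≥0 => -B s ω + -(μ / σ) * s) (by fun_prop) τ hZ₀ hσ]
  have : ∀ t : ℝ≥0, gbm Z₀ μ σ B t ω = Z₀ * Real.exp (-σ * (-B t ω + -(μ / σ) * t)) := by
    intro t
    rw [gbm]
    congr 2
    field_simp
    ring
  simp only [classicalDiscountedPayoff, lookbackPayoff, this]
  rw [← this τ, gbm]

lemma classicalDiscountedPayoff_nonneg {Z₀ r μ σ : ℝ} (hZ₀ : 0 < Z₀) (hσ : 0 < σ) {ω : Ω}
    (hω : Continuous fun t => B t ω) (τ : ℝ≥0) :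
    0 ≤ classicalDiscountedPayoff Z₀ r μ σ B τ ω := by
  rw [classicalDiscountedPayoff_eq hZ₀ hσ hω]
  refine mul_nonneg (Real.exp_pos _).le (sub_nonneg.2 ?_)
  refine mul_le_mul_of_nonneg_left (Real.exp_le_exp.2 ?_) hZ₀.le
  have := le_csSup (bddAbove_image_Icc (f := fun s : ℝ≥0 => -B s ω + -(μ / σ) * s)
    (by fun_prop) τ) ⟨τ, by simp, rfl⟩
  have h2 : -σ * runMax (fun s => -B s ω + -(μ / σ) * s) τ ≤ -σ * (-B τ ω + -(μ / σ) * τ) :=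
    mul_le_mul_of_nonpos_left this (by linarith)
  refine h2.trans (le_of_eq ?_)
  field_simp
  ring

/-- The classical lookback price, as an expectation under the original measure. -/
theorem integral_classicalDiscountedPayoff [IsProbabilityMeasure P] (hB : IsBrownianReal B P)
    {Z₀ r μ σ : ℝ} (hZ₀ : 0 < Z₀) (hr : r ≠ 0) (hσ : 0 < σ) (τ : ℝ≥0) :
    Integrable (fun ω => girsanovDensity (gammaParam r μ σ) B τ ω *
      classicalDiscountedPayoff Z₀ r μ σ B τ ω) P ∧
    ∫ ω, girsanovDensity (gammaParam r μ σ) B τ ω * classicalDiscountedPayoff Z₀ r μ σ B τ ω ∂P =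
      lookbackFormula Z₀ r σ τ ∧
    lookbackFormula Z₀ r σ τ ∈ Set.Icc 0 Z₀ := by
  set γ := gammaParam r μ σ with hγ
  set X : Ω → ℝ := fun ω => runMax (fun s => -B s ω + -(μ / σ) * s) τ with hX
  obtain ⟨hi1, he1⟩ : Integrable (fun ω => girsanovDensity γ B τ ω * Real.exp (-σ * X ω)) P ∧
      ∫ ω, girsanovDensity γ B τ ω * Real.exp (-σ * X ω) ∂P =
      (1 - σ ^ 2 / (2 * r)) * Phi ((r / σ - σ / 2) * √τ) +
      (1 + σ ^ 2 / (2 * r)) * Real.exp (r * τ) * (1 - Phi ((r / σ + σ / 2) * √τ)) := by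
    rcases eq_or_ne τ 0 with rfl | hτ
    · refine ⟨(integral_exp_neg_runMax_zero hB r μ σ).1,
        (integral_exp_neg_runMax_zero hB r μ σ).2.trans ?_⟩
      simp [Phi_zero]
      ring
    · exact integral_exp_neg_runMax hB hr hσ (pos_of_ne_zero hτ)
  obtain ⟨hi2, he2⟩ := integral_exp_brownian hB.toIsPreBrownianReal (σ - γ)
    (μ * τ - γ ^ 2 / 2 * τ) τ
  have hγσ : γ * σ = μ - r + σ ^ 2 / 2 := by
    rw [hγ, gammaParam]; field_simp
  -- The choice of `γ` enters here: it makes the discounted price have `Q`-expectation `Z₀`.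
  have hexp : (σ - γ) ^ 2 * τ / 2 + (μ * τ - γ ^ 2 / 2 * τ) = r * τ := by
    linear_combination (-τ : ℝ) * hγσ
  rw [hexp] at he2
  have hae : (fun ω => girsanovDensity γ B τ ω * classicalDiscountedPayoff Z₀ r μ σ B τ ω) =ᵐ[P]
      fun ω => Real.exp (-(r * τ)) * Z₀ * (Real.exp ((σ - γ) * B τ ω + (μ * τ - γ ^ 2 / 2 * τ)) -
        girsanovDensity γ B τ ω * Real.exp (-σ * X ω)) := by
    filter_upwards [hB.cont] with ω hω
    rw [classicalDiscountedPayoff_eq hZ₀ hσ hω]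
    have : Real.exp ((σ - γ) * B τ ω + (μ * τ - γ ^ 2 / 2 * τ)) =
        girsanovDensity γ B τ ω * Real.exp (μ * τ + σ * B τ ω) := by
      rw [girsanovDensity, ← Real.exp_add]
      congr 1
      ring
    rw [this]
    ring
  have hval : ∫ ω, girsanovDensity γ B τ ω * classicalDiscountedPayoff Z₀ r μ σ B τ ω ∂P =
      lookbackFormula Z₀ r σ τ := by
    rw [integral_congr_ae hae, integral_const_mul, integral_sub hi2 hi1, he1, he2,
      lookbackFormula]
    have : Real.exp (-(r * τ)) * Real.exp (r * τ) = 1 := by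
      rw [← Real.exp_add]; simp
    linear_combination (Z₀ * (1 - (1 + σ ^ 2 / (2 * r)) * (1 - Phi ((r / σ + σ / 2) * √τ)))) * this
  refine ⟨((hi2.sub hi1).const_mul _).congr hae.symm, hval, ?_, ?_⟩
  · rw [← hval]
    refine integral_nonneg_of_ae ?_
    filter_upwards [hB.cont] with ω hω
    exact mul_nonneg (Real.exp_pos _).le (classicalDiscountedPayoff_nonneg hZ₀ hσ hω τ)
  -- Dropping the nonnegative minimum leaves the discounted terminal price, of expectation `Z₀`.
  · rw [← hval, integral_congr_ae hae, integral_const_mul, integral_sub hi2 hi1, he2]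
    have h1 : 0 ≤ ∫ ω, girsanovDensity γ B τ ω * Real.exp (-σ * X ω) ∂P :=
      integral_nonneg fun ω => mul_nonneg (Real.exp_pos _).le (Real.exp_pos _).le
    have h2 : Real.exp (-(r * τ)) * Real.exp (r * τ) = 1 := by
      rw [← Real.exp_add]; simp
    have h3 : 0 ≤ Real.exp (-(r * τ)) * Z₀ * ∫ ω, girsanovDensity γ B τ ω *
        Real.exp (-σ * X ω) ∂P := by positivity
    linear_combination h3 + Z₀ * h2

/-! ### Independent random times -/

/-- The value at time `τ` of a continuous path sampled at the times `k / (n + 1)`. -/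
noncomputable def evalSample (τ : ℝ≥0) (b : ℕ × ℕ → ℝ) : ℝ :=
  Filter.liminf (fun n : ℕ => b (⌈τ * (n + 1)⌉₊, n)) Filter.atTop

/-- The sample of a path at the times `k / (n + 1)`. -/
noncomputable def samplePath (f : ℝ≥0 → ℝ) (p : ℕ × ℕ) : ℝ := f (p.1 / (p.2 + 1))

lemma evalSample_samplePath {f : ℝ≥0 → ℝ} (hf : Continuous f) (τ : ℝ≥0) :
    evalSample τ (samplePath f) = f τ := by
  refine Filter.Tendsto.liminf_eq ?_
  have h1 : Filter.Tendsto (fun n : ℕ => ((⌈τ * (n + 1)⌉₊ : ℝ≥0) / (n + 1))) Filter.atTop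
      (nhds τ) := by
    have h := (tendsto_nat_ceil_mul_div_atTop (R := ℝ) τ.2).comp (tendsto_natCast_atTop_atTop.comp
      (Filter.tendsto_add_atTop_nat 1))
    rw [← NNReal.tendsto_coe]
    refine h.congr fun n => ?_
    simp only [Function.comp_apply]
    push_cast
    congr 2
  exact (hf.tendsto τ).comp h1

/-- Evaluation `(t, f) ↦ f t` is not jointly measurable for the product σ-algebra on all paths. On
countable samples it is a `liminf` of measurable maps, and it agrees with evaluation on continuous
paths. -/
lemma measurable_evalSample : Measurable fun p : ℝ≥0 × (ℕ × ℕ → ℝ) => evalSample p.1 p.2 := by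
  refine Measurable.liminf fun n => ?_
  have h1 : Measurable fun q : ℕ × (ℕ × ℕ → ℝ) => q.2 (q.1, n) :=
    measurable_from_prod_countable_right fun k => measurable_pi_apply (k, n)
  exact h1.comp ((Nat.measurable_ceil.comp (measurable_fst.mul_const _)).prodMk measurable_snd)

/-- The weighted discounted payoff as a function of the expiry and the sampled path. -/
noncomputable def samplePayoff (Z₀ r μ σ : ℝ) (p : ℝ≥0 × (ℕ × ℕ → ℝ)) : ℝ :=
  Real.exp (-gammaParam r μ σ * evalSample p.1 p.2 - gammaParam r μ σ ^ 2 / 2 * p.1) *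
    (Real.exp (-(r * p.1)) * (Z₀ * Real.exp (μ * p.1 + σ * evalSample p.1 p.2) -
      Z₀ * Real.exp (-σ * ⨆ q : ℕ × ℕ, (-evalSample (p.1 * gridPoint q) p.2 +
        -(μ / σ) * (p.1 * gridPoint q : ℝ≥0)))))

lemma measurable_samplePayoff (Z₀ r μ σ : ℝ) : Measurable (samplePayoff Z₀ r μ σ) := by
  have h1 := measurable_evalSample
  have h2 : Measurable fun p : ℝ≥0 × (ℕ × ℕ → ℝ) => ⨆ q : ℕ × ℕ,
      (-evalSample (p.1 * gridPoint q) p.2 + -(μ / σ) * (p.1 * gridPoint q : ℝ≥0)) := by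
    refine Measurable.iSup fun q => ?_
    have h3 : Measurable fun p : ℝ≥0 × (ℕ × ℕ → ℝ) => evalSample (p.1 * gridPoint q) p.2 :=
      h1.comp (f := fun p : ℝ≥0 × (ℕ × ℕ → ℝ) => (p.1 * gridPoint q, p.2)) (by fun_prop)
    fun_prop
  unfold samplePayoff
  fun_prop

lemma samplePayoff_samplePath {Z₀ r μ σ : ℝ} (hZ₀ : 0 < Z₀) (hσ : 0 < σ) {ω : Ω}
    (hω : Continuous fun t => B t ω) (τ : ℝ≥0) :
    samplePayoff Z₀ r μ σ (τ, samplePath fun t => B t ω) =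
      girsanovDensity (gammaParam r μ σ) B τ ω * classicalDiscountedPayoff Z₀ r μ σ B τ ω := by
  rw [classicalDiscountedPayoff_eq hZ₀ hσ hω, runMax_eq_iSup (by fun_prop)]
  simp only [samplePayoff, evalSample_samplePath hω, girsanovDensity]

lemma measurable_lookbackFormula (Z₀ r σ : ℝ) : Measurable (lookbackFormula Z₀ r σ) := by
  have := continuous_Phi
  unfold lookbackFormula
  fun_prop

/-- The price of the lookback call at an independent random expiry. -/
theorem integral_classicalDiscountedPayoff_random [IsProbabilityMeasure P]
    (hB : IsBrownianReal B P) {Z₀ r μ σ : ℝ} (hZ₀ : 0 < Z₀) (hr : r ≠ 0) (hσ : 0 < σ)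
    {τ : Ω → ℝ≥0} (hτ : AEMeasurable τ P) (hind : IndepFun τ (fun ω t => B t ω) P) :
    Integrable (fun ω => girsanovDensity (gammaParam r μ σ) B (τ ω) ω *
      classicalDiscountedPayoff Z₀ r μ σ B (τ ω) ω) P ∧
    Integrable (fun ω => lookbackFormula Z₀ r σ (τ ω)) P ∧
    ∫ ω, girsanovDensity (gammaParam r μ σ) B (τ ω) ω *
      classicalDiscountedPayoff Z₀ r μ σ B (τ ω) ω ∂P = ∫ ω, lookbackFormula Z₀ r σ (τ ω) ∂P := by
  set β : Ω → (ℕ × ℕ → ℝ) := fun ω => samplePath fun t => B t ω with hβ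
  have hβm : AEMeasurable β P := aemeasurable_pi_lambda _ fun p => hB.aemeasurable _
  have hind2 : IndepFun τ β P := by
    have hm : Measurable fun f : ℝ≥0 → ℝ => samplePath f :=
      measurable_pi_lambda _ fun p => measurable_pi_apply _
    exact hind.comp measurable_id hm
  have hmap := (indepFun_iff_map_prod_eq_prod_map_map hτ hβm).1 hind2
  have hΨ := measurable_samplePayoff Z₀ r μ σ
  have : IsProbabilityMeasure (P.map τ) := Measure.isProbabilityMeasure_map hτ
  have : IsProbabilityMeasure (P.map β) := Measure.isProbabilityMeasure_map hβm
  -- The payoff is almost surely nonnegative, so its `L¹` norm is the price itself; the bound of the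
  -- price by `Z₀` then gives joint integrability.
  have hfix (t : ℝ≥0) : Integrable (fun b => samplePayoff Z₀ r μ σ (t, b)) (P.map β) ∧
      ∫ b, samplePayoff Z₀ r μ σ (t, b) ∂P.map β = lookbackFormula Z₀ r σ t ∧
      ∫ b, ‖samplePayoff Z₀ r μ σ (t, b)‖ ∂P.map β = lookbackFormula Z₀ r σ t := by
    obtain ⟨h1, h2, -⟩ := integral_classicalDiscountedPayoff hB hZ₀ hr hσ (μ := μ) t
    have hm : Measurable fun b => samplePayoff Z₀ r μ σ (t, b) :=
      hΨ.comp (measurable_const.prodMk measurable_id)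
    have hae : (fun ω => samplePayoff Z₀ r μ σ (t, β ω)) =ᵐ[P] fun ω =>
        girsanovDensity (gammaParam r μ σ) B t ω * classicalDiscountedPayoff Z₀ r μ σ B t ω := by
      filter_upwards [hB.cont] with ω hω
      exact samplePayoff_samplePath hZ₀ hσ hω t
    refine ⟨(integrable_map_measure hm.aestronglyMeasurable hβm).2 (h1.congr hae.symm), ?_, ?_⟩
    · rw [integral_map hβm hm.aestronglyMeasurable, integral_congr_ae hae, h2]
    · rw [integral_map hβm hm.norm.aestronglyMeasurable, ← h2]
      refine integral_congr_ae ?_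
      filter_upwards [hB.cont, hae] with ω hω h3
      rw [h3, Real.norm_of_nonneg]
      exact mul_nonneg (Real.exp_pos _).le (classicalDiscountedPayoff_nonneg hZ₀ hσ hω t)
  have hL : Measurable fun t : ℝ≥0 => lookbackFormula Z₀ r σ t :=
    (measurable_lookbackFormula Z₀ r σ).comp measurable_coe_nnreal_real
  have hLi : Integrable (fun t : ℝ≥0 => lookbackFormula Z₀ r σ t) (P.map τ) := by
    refine Integrable.of_bound (C := Z₀) hL.aestronglyMeasurable
      (Filter.Eventually.of_forall fun t => ?_)
    obtain ⟨-, -, h1, h2⟩ := integral_classicalDiscountedPayoff hB hZ₀ hr hσ (μ := μ) t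
    rwa [Real.norm_of_nonneg h1]
  have hprod : Integrable (samplePayoff Z₀ r μ σ) ((P.map τ).prod (P.map β)) := by
    rw [integrable_prod_iff hΨ.aestronglyMeasurable]
    refine ⟨Filter.Eventually.of_forall fun t => (hfix t).1, ?_⟩
    simpa only [(hfix _).2.2] using hLi
  have hpair : AEMeasurable (fun ω => (τ ω, β ω)) P := hτ.prodMk hβm
  have hae : (fun ω => samplePayoff Z₀ r μ σ (τ ω, β ω)) =ᵐ[P] fun ω =>
      girsanovDensity (gammaParam r μ σ) B (τ ω) ω *
        classicalDiscountedPayoff Z₀ r μ σ B (τ ω) ω := by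
    filter_upwards [hB.cont] with ω hω
    exact samplePayoff_samplePath hZ₀ hσ hω (τ ω)
  refine ⟨?_, hLi.comp_aemeasurable hτ, ?_⟩
  · rw [← hmap] at hprod
    exact (hprod.comp_aemeasurable hpair).congr hae
  · rw [← integral_congr_ae hae, ← integral_map hpair hΨ.aestronglyMeasurable, hmap,
      integral_prod _ hprod, ← integral_map hτ hL.aestronglyMeasurable]
    exact integral_congr_ae (Filter.Eventually.of_forall fun t => (hfix t).2.1)

end SubordinatedBS

namespace SubordinatedBS

/-! ### The Laplace exponent -/

/-- The integrand is at most `max u 1 * min 1 x`. -/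
lemma integrableOn_one_sub_exp {ν : Measure ℝ} (hν : IsInfiniteLevyMeasure ν) {u : ℝ} (hu : 0 ≤ u) :
    IntegrableOn (fun x => 1 - Real.exp (-(u * x))) (Set.Ioi 0) ν := by
  have hmin : IntegrableOn (fun x : ℝ => min 1 x) (Set.Ioi 0) ν := by
    refine ⟨by fun_prop, ?_⟩
    rw [hasFiniteIntegral_iff_ofReal]
    · exact hν.lintegral_min_lt_top
    · filter_upwards [ae_restrict_mem measurableSet_Ioi] with x hx
      exact le_min zero_le_one (le_of_lt hx)
  refine (hmin.const_mul (max u 1)).mono' (by fun_prop) ?_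
  filter_upwards [ae_restrict_mem measurableSet_Ioi] with x hx
  have hx' : 0 < x := hx
  have h1 : Real.exp (-(u * x)) ≤ 1 := Real.exp_le_one_iff.2 (by nlinarith)
  rw [Real.norm_of_nonneg (by linarith)]
  have h2 := Real.add_one_le_exp (-(u * x))
  rcases le_total 1 x with h | h
  · rw [min_eq_left h]
    linarith [le_max_right u 1, Real.exp_pos (-(u * x))]
  · rw [min_eq_right h]
    nlinarith [le_max_left u 1]

/-- By monotone convergence the limit is the total mass of `ν` on `(0, ∞)`, which is infinite. -/
lemma tendsto_laplaceExponent {ν : Measure ℝ} (hν : IsInfiniteLevyMeasure ν) :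
    Filter.Tendsto (fun n : ℕ => laplaceExponent ν n) Filter.atTop Filter.atTop := by
  have hnn (n : ℕ) : ∀ x ∈ Set.Ioi (0 : ℝ), 0 ≤ 1 - Real.exp (-(n * x)) := fun x hx => by
    have hx' : 0 < x := hx
    rw [sub_nonneg, Real.exp_le_one_iff]
    have : 0 ≤ (n : ℝ) * x := by positivity
    linarith
  have h1 (n : ℕ) : ENNReal.ofReal (laplaceExponent ν n) =
      ∫⁻ x in Set.Ioi 0, ENNReal.ofReal (1 - Real.exp (-(n * x))) ∂ν := by
    refine ofReal_integral_eq_lintegral_ofReal (integrableOn_one_sub_exp hν n.cast_nonneg) ?_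
    filter_upwards [ae_restrict_mem measurableSet_Ioi] with x hx using hnn n x hx
  have h2 : Filter.Tendsto (fun n : ℕ => ENNReal.ofReal (laplaceExponent ν n)) Filter.atTop
      (nhds ∞) := by
    have h3 : ∫⁻ x in Set.Ioi (0 : ℝ), 1 ∂ν = ∞ := by simpa using hν.infinite
    simp only [h1]
    rw [← h3]
    refine lintegral_tendsto_of_tendsto_of_monotone (fun n => by fun_prop) ?_ ?_
    · filter_upwards [ae_restrict_mem measurableSet_Ioi] with x hx n m hnm
      have hx' : 0 < x := hx
      have : (n : ℝ) ≤ m := by exact_mod_cast hnm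
      dsimp only
      gcongr
    · filter_upwards [ae_restrict_mem measurableSet_Ioi] with x hx
      have hx' : 0 < x := hx
      have h4 : Filter.Tendsto (fun n : ℕ => Real.exp (-(n * x))) Filter.atTop (nhds 0) :=
        Real.tendsto_exp_neg_atTop_nhds_zero.comp
          (tendsto_natCast_atTop_atTop.atTop_mul_const hx')
      have h5 := ENNReal.tendsto_ofReal (h4.const_sub 1)
      simpa using h5
  exact ENNReal.tendsto_ofReal_nhds_top.1 h2

/-! ### The paths of a subordinator -/

variable {Ω : Type*} {mΩ : MeasurableSpace Ω} {P : Measure Ω} {U : ℝ≥0 → Ω → ℝ} {ν : Measure ℝ}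

lemma integral_indicator_one_of_nullMeasurableSet {s : Set Ω} (hs : NullMeasurableSet s P) :
    ∫ ω, s.indicator (1 : Ω → ℝ) ω ∂P = P.real s := by
  rw [integral_indicator₀ hs]
  simp

lemma IsSubordinator.integrable_exp (hU : IsSubordinator U ν P) (t : ℝ≥0) {u : ℝ} (hu : 0 < u) :
    Integrable (fun ω => Real.exp (-(u * U t ω))) P := by
  -- The integral of a non-integrable function is `0` by convention, but the Laplace transform is
  -- positive.
  by_contra h
  have := hU.laplace t u hu
  rw [integral_undef h] at this
  exact (Real.exp_pos _).ne this

/-- Markov's inequality: the indicator of `U t ≤ 0` is at most `exp(-u U t)`, whose expectation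
`exp(-t ψ(u))` tends to `0` along the integers. -/
lemma IsSubordinator.ae_pos [IsProbabilityMeasure P] (hU : IsSubordinator U ν P)
    (hν : IsInfiniteLevyMeasure ν) {t : ℝ≥0} (ht : 0 < t) : ∀ᵐ ω ∂P, 0 < U t ω := by
  have hset : NullMeasurableSet {ω | U t ω ≤ 0} P :=
    nullMeasurableSet_le (hU.aemeasurable t) aemeasurable_const
  have hle (n : ℕ) : P.real {ω | U t ω ≤ 0} ≤ Real.exp (-(t * laplaceExponent ν (n + 1 : ℕ))) := by
    have hn : (0 : ℝ) < (n + 1 : ℕ) := by positivity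
    rw [← hU.laplace t _ hn, ← integral_indicator_one_of_nullMeasurableSet hset]
    refine integral_mono ((integrable_const (1 : ℝ)).indicator₀ hset)
      (hU.integrable_exp t hn) fun ω => ?_
    by_cases hω : ω ∈ {ω | U t ω ≤ 0}
    · have hω' : U t ω ≤ 0 := hω
      simp only [Set.indicator_of_mem hω, Pi.one_apply]
      exact Real.one_le_exp (neg_nonneg.2 (mul_nonpos_iff.2 (Or.inl ⟨hn.le, hω'⟩)))
    · simp only [Set.indicator_of_notMem hω]
      exact (Real.exp_pos _).le
  have hlim : Filter.Tendsto (fun n : ℕ => Real.exp (-(t * laplaceExponent ν (n + 1 : ℕ))))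
      Filter.atTop (nhds 0) := by
    have ht' : (0 : ℝ) < t := ht
    exact Real.tendsto_exp_neg_atTop_nhds_zero.comp
      (((tendsto_laplaceExponent hν).comp (Filter.tendsto_add_atTop_nat 1)).const_mul_atTop ht')
  have h0 : P.real {ω | U t ω ≤ 0} ≤ 0 := ge_of_tendsto' hlim hle
  have h1 : P {ω | U t ω ≤ 0} = 0 := by
    rw [← measureReal_eq_zero_iff]
    exact le_antisymm h0 measureReal_nonneg
  rw [ae_iff]
  simpa using h1

/-- Stationarity makes the increment between any two rational times almost surely positive;
monotonicity extends this to all times by inserting two rationals. -/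
lemma IsSubordinator.ae_strictMono [IsProbabilityMeasure P] (hU : IsSubordinator U ν P)
    (hν : IsInfiniteLevyMeasure ν) : ∀ᵐ ω ∂P, StrictMono fun t => U t ω := by
  have h1 : ∀ᵐ ω ∂P, ∀ p : ℚ × ℚ, Real.toNNReal p.1 < Real.toNNReal p.2 →
      U (Real.toNNReal p.1) ω < U (Real.toNNReal p.2) ω := by
    rw [ae_all_iff]
    intro p
    by_cases hp : Real.toNNReal p.1 < Real.toNNReal p.2
    · obtain ⟨h, hh⟩ : ∃ h, Real.toNNReal p.2 = Real.toNNReal p.1 + h :=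
        ⟨_, (add_tsub_cancel_of_le hp.le).symm⟩
      have hpos : 0 < h := by
        rw [hh] at hp
        simpa using hp
      have h2 := (hU.stationary_increments (Real.toNNReal p.1) h).symm.ae_snd
        (p := fun x => 0 < x) measurableSet_Ioi (hU.ae_pos hν hpos)
      filter_upwards [h2] with ω hω _
      rw [hh]
      linarith
    · exact Filter.Eventually.of_forall fun ω h => absurd h hp
  filter_upwards [h1, hU.monotone] with ω hω hmono s t hst
  obtain ⟨q₁, -, hq₁, hq₁'⟩ := (NNReal.lt_iff_exists_rat_btwn _ _).1 hst
  obtain ⟨q₂, -, hq₂, hq₂'⟩ := (NNReal.lt_iff_exists_rat_btwn _ _).1 hq₁'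
  exact (hmono hq₁.le).trans_lt ((hω (q₁, q₂) hq₂).trans_le (hmono hq₂'.le))

/-- With `ψ(N) > 0`, staying below `k` at all integer times has probability at most `exp(N k) exp(-n
ψ(N))` for every `n`. -/
lemma IsSubordinator.ae_unbounded [IsProbabilityMeasure P] (hU : IsSubordinator U ν P)
    (hν : IsInfiniteLevyMeasure ν) : ∀ᵐ ω ∂P, ∀ x : ℝ, ∃ t, x < U t ω := by
  obtain ⟨N, hN, hψ⟩ : ∃ N : ℕ, 0 < N ∧ 0 < laplaceExponent ν N :=
    ((Filter.eventually_gt_atTop 0).and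
      ((tendsto_laplaceExponent hν).eventually_gt_atTop 0)).exists
  have hN' : (0 : ℝ) < N := by exact_mod_cast hN
  have key (k : ℕ) : ∀ᵐ ω ∂P, ∃ n : ℕ, (k : ℝ) < U n ω := by
    have hset (n : ℕ) : NullMeasurableSet {ω | U n ω ≤ k} P :=
      nullMeasurableSet_le (hU.aemeasurable n) aemeasurable_const
    have hle (n : ℕ) : P.real {ω | ∀ n : ℕ, U n ω ≤ k} * Real.exp (-(N * k)) ≤
        Real.exp (-(n * laplaceExponent ν N)) := by
      have h1 : P.real {ω | ∀ n : ℕ, U n ω ≤ k} ≤ P.real {ω | U n ω ≤ k} :=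
        measureReal_mono fun ω hω => hω n
      have h2 := hU.laplace n N hN'
      refine (mul_le_mul_of_nonneg_right h1 (Real.exp_pos _).le).trans ?_
      rw [NNReal.coe_natCast] at h2
      rw [← h2, ← integral_indicator_one_of_nullMeasurableSet (hset n), ← integral_mul_const]
      refine integral_mono (((integrable_const (1 : ℝ)).indicator₀ (hset n)).mul_const _)
        (hU.integrable_exp n hN') fun ω => ?_
      by_cases hω : ω ∈ {ω | U n ω ≤ k}
      · have hω' : U n ω ≤ k := hω
        simp only [Set.indicator_of_mem hω, Pi.one_apply, one_mul, Real.exp_le_exp]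
        nlinarith
      · simp only [Set.indicator_of_notMem hω, zero_mul]
        exact (Real.exp_pos _).le
    have hlim : Filter.Tendsto (fun n : ℕ => Real.exp (-(n * laplaceExponent ν N)))
        Filter.atTop (nhds 0) :=
      Real.tendsto_exp_neg_atTop_nhds_zero.comp (tendsto_natCast_atTop_atTop.atTop_mul_const hψ)
    have h0 := ge_of_tendsto' hlim hle
    have h1 : P.real {ω | ∀ n : ℕ, U n ω ≤ k} ≤ 0 := by
      by_contra hcon
      exact absurd h0 (mul_pos (not_le.1 hcon) (Real.exp_pos _)).not_ge
    have h2 : P {ω | ∀ n : ℕ, U n ω ≤ k} = 0 := by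
      rw [← measureReal_eq_zero_iff]
      exact le_antisymm h1 measureReal_nonneg
    rw [ae_iff]
    simpa using h2
  filter_upwards [ae_all_iff.2 key] with ω hω x
  obtain ⟨k, hk⟩ := exists_nat_gt x
  obtain ⟨n, hn⟩ := hω k
  exact ⟨n, hk.trans hn⟩

/-! ### The inverse of an increasing path -/

/-- The typical paths of a strictly increasing subordinator. -/
structure IsRegularPath (f : ℝ≥0 → ℝ) : Prop where
  zero : f 0 = 0
  strictMono : StrictMono f
  unbounded : ∀ x : ℝ, ∃ t, x < f t

lemma IsSubordinator.ae_isRegularPath [IsProbabilityMeasure P] (hU : IsSubordinator U ν P)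
    (hν : IsInfiniteLevyMeasure ν) : ∀ᵐ ω ∂P, IsRegularPath fun t => U t ω := by
  filter_upwards [hU.zero, hU.ae_strictMono hν, hU.ae_unbounded hν] with ω h1 h2 h3
  exact ⟨h1, h2, h3⟩

section path

variable {ω : Ω}

lemma inverseSubordinator_le (hω : IsRegularPath fun t => U t ω) {T τ : ℝ≥0} (h : (T : ℝ) < U τ ω) :
    inverseSubordinator U T ω ≤ τ := by
  refine csInf_le (OrderBot.bddBelow _) ⟨?_, h⟩
  -- The infimum runs over positive times only; time `0` is harmless because `U 0 = 0 ≤ T`.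
  by_contra hcon
  rw [not_lt, nonpos_iff_eq_zero] at hcon
  have h0 : U 0 ω = 0 := hω.zero
  rw [hcon, h0] at h
  exact absurd h T.2.not_gt

lemma lt_of_inverseSubordinator_lt (hω : IsRegularPath fun t => U t ω) {T τ : ℝ≥0}
    (h : inverseSubordinator U T ω < τ) : (T : ℝ) < U τ ω := by
  -- Unboundedness makes the defining set nonempty, so its infimum is not the default value `0` of
  -- the empty set.
  obtain ⟨t, ht⟩ := hω.unbounded T
  have hne : {τ : ℝ≥0 | 0 < τ ∧ (T : ℝ) < U τ ω}.Nonempty := by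
    refine ⟨t, ?_, ht⟩
    by_contra hcon
    rw [not_lt, nonpos_iff_eq_zero] at hcon
    have h0 : U 0 ω = 0 := hω.zero
    rw [hcon] at ht
    simp only [h0] at ht
    exact absurd ht T.2.not_gt
  obtain ⟨s, ⟨-, hs⟩, hsτ⟩ := exists_lt_of_csInf_lt hne h
  exact hs.trans (hω.strictMono hsτ)

/-- Jumps of `U` become flat stretches of `S`, and strict monotonicity of `U` rules out jumps of
`S`. Hence the minimum of `Z ∘ S` over `[0, T]` is that of `Z` over `[0, S(T)]`. -/
lemma inverseSubordinator_image (hω : IsRegularPath fun t => U t ω) (T : ℝ≥0) :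
    (fun t => inverseSubordinator U t ω) '' Set.Icc 0 T =
      Set.Icc 0 (inverseSubordinator U T ω) := by
  apply Set.Subset.antisymm
  · rintro _ ⟨t, ⟨-, ht⟩, rfl⟩
    refine ⟨zero_le, le_of_forall_gt fun c hc => ?_⟩
    obtain ⟨d, hd1, hd2⟩ := exists_between hc
    have h1 := lt_of_inverseSubordinator_lt hω hd1
    have h2 : (t : ℝ) ≤ T := ht
    exact (inverseSubordinator_le hω (h2.trans_lt h1)).trans_lt hd2
  · rintro s ⟨-, hs⟩
    rcases eq_or_lt_of_le hs with rfl | hs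
    · exact ⟨T, ⟨zero_le, le_rfl⟩, rfl⟩
    · have hU0 : 0 ≤ U s ω := by
        have h0 : U 0 ω = 0 := hω.zero
        rw [← h0]
        exact hω.strictMono.monotone zero_le
      -- The level `U s` is mapped to `s`, since `U τ > U s` exactly for `τ > s`.
      refine ⟨⟨U s ω, hU0⟩, ⟨zero_le, ?_⟩, ?_⟩
      · by_contra hcon
        exact absurd hs (inverseSubordinator_le hω (not_le.1 hcon)).not_gt
      · have : {τ : ℝ≥0 | 0 < τ ∧ U s ω < U τ ω} = Set.Ioi s := by
          ext τ
          have := hω.strictMono.lt_iff_lt (a := s) (b := τ)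
          constructor
          · exact fun h => this.1 h.2
          · exact fun h => ⟨zero_le.trans_lt h, this.2 h⟩
        simp only [inverseSubordinator]
        exact (congrArg sInf this).trans csInf_Ioi

end path

lemma IsSubordinator.aemeasurable_inverse [IsProbabilityMeasure P] (hU : IsSubordinator U ν P)
    (hν : IsInfiniteLevyMeasure ν) (T : ℝ≥0) : AEMeasurable (inverseSubordinator U T) P := by
  classical
  -- Rational times suffice for the infimum; it is taken in `ℝ≥0∞` so that times not yet past level
  -- `T` can be given the neutral value `∞`.
  have h1 : AEMeasurable (fun ω => (⨅ q : ℚ, if (T : ℝ) < U (Real.toNNReal q) ω then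
      (Real.toNNReal q : ℝ≥0∞) else ∞).toNNReal) P := by
    refine AEMeasurable.ennreal_toNNReal (AEMeasurable.iInf fun q => ?_)
    have : Measurable fun x : ℝ => if (T : ℝ) < x then (Real.toNNReal q : ℝ≥0∞) else ∞ :=
      Measurable.ite measurableSet_Ioi measurable_const measurable_const
    exact this.comp_aemeasurable (hU.aemeasurable _)
  refine h1.congr ?_
  filter_upwards [hU.ae_isRegularPath hν] with ω hω
  rw [← ENNReal.toNNReal_coe (inverseSubordinator U T ω)]
  congr 1
  apply le_antisymm
  · refine le_of_forall_gt fun c hc => ?_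
    obtain ⟨d, hd1, hd2⟩ := ENNReal.lt_iff_exists_nnreal_btwn.1 hc
    obtain ⟨q, -, hq1, hq2⟩ := (NNReal.lt_iff_exists_rat_btwn _ _).1 (ENNReal.coe_lt_coe.1 hd1)
    refine (iInf_le _ q).trans_lt ?_
    rw [if_pos (lt_of_inverseSubordinator_lt hω hq1)]
    exact (ENNReal.coe_lt_coe.2 hq2).trans hd2
  · refine le_iInf fun q => ?_
    split_ifs with h
    · exact ENNReal.coe_le_coe.2 (inverseSubordinator_le hω h)
    · exact le_top

lemma subordinatedDiscountedPayoff_eq {Z₀ r μ σ : ℝ} {B : ℝ≥0 → Ω → ℝ} {ω : Ω}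
    (hω : IsRegularPath fun t => U t ω) (T : ℝ≥0) :
    subordinatedDiscountedPayoff Z₀ r μ σ B (inverseSubordinator U) T ω =
      classicalDiscountedPayoff Z₀ r μ σ B (inverseSubordinator U T ω) ω := by
  simp only [subordinatedDiscountedPayoff, classicalDiscountedPayoff, lookbackPayoff,
    subordinatedGBM]
  rw [← inverseSubordinator_image hω, Set.image_image]

end SubordinatedBS

namespace SubordinatedBS

/-! ### Vertical estimates for the Gamma function -/

/-- On this line `1 - s` is the conjugate of `s`, so Euler's reflection formula computes the modulus
exactly. -/
lemma norm_Gamma_half (y : ℝ) :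
    ‖Complex.Gamma (1 / 2 + y * Complex.I)‖ ^ 2 = Real.pi / Real.cosh (Real.pi * y) := by
  have h1 := Complex.Gamma_mul_Gamma_one_sub (1 / 2 + y * Complex.I)
  have h2 : (1 : ℂ) - (1 / 2 + y * Complex.I) = (starRingEnd ℂ) (1 / 2 + y * Complex.I) := by
    simp only [map_add, map_mul, map_div₀, Complex.conj_ofReal, Complex.conj_I, map_one,
      Complex.conj_ofNat]
    ring
  have h3 : Complex.sin (Real.pi * (1 / 2 + y * Complex.I)) = Real.cosh (Real.pi * y) := by
    rw [show (Real.pi * (1 / 2 + y * Complex.I) : ℂ) =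
      Real.pi * y * Complex.I + Real.pi / 2 by ring, Complex.sin_add_pi_div_two,
      Complex.cos_mul_I]
    push_cast
    rfl
  rw [h2, Complex.Gamma_conj, Complex.mul_conj, Complex.normSq_eq_norm_sq, h3] at h1
  exact_mod_cast h1

/-- `Γ(s) Γ(b) = Γ(s + b) B(s, b)`, and the Beta integral is bounded by its value with `s` replaced
by `Re s`. This compares vertical lines and transfers the exact value on `Re s = 1/2` to others. -/
lemma norm_Gamma_le_of_add {x b : ℝ} (hx : 0 < x) (hb : 0 < b) :
    ∃ C : ℝ, 0 < C ∧ ∀ y : ℝ, ‖Complex.Gamma (x + y * Complex.I)‖ ≤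
      C * ‖Complex.Gamma (x + b + y * Complex.I)‖ := by
  set M : ℝ := ∫ t in (0 : ℝ)..1, ‖(t : ℂ) ^ ((x : ℂ) - 1) * (1 - (t : ℂ)) ^ ((b : ℂ) - 1)‖ with hM
  have hM0 : 0 ≤ M := intervalIntegral.integral_nonneg zero_le_one fun _ _ => norm_nonneg _
  have hΓ : 0 < Real.Gamma b := Real.Gamma_pos_of_pos hb
  refine ⟨(M + 1) / Real.Gamma b, by positivity, fun y => ?_⟩
  have h1 := Complex.Gamma_mul_Gamma_eq_betaIntegral (s := x + y * Complex.I) (t := b)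
    (by simpa using hx) (by simpa using hb)
  have h2 : ‖Complex.betaIntegral (x + y * Complex.I) b‖ ≤ M := by
    rw [Complex.betaIntegral]
    refine (intervalIntegral.norm_integral_le_integral_norm zero_le_one).trans (le_of_eq ?_)
    rw [hM, intervalIntegral.integral_of_le zero_le_one, intervalIntegral.integral_of_le zero_le_one,
      integral_Ioc_eq_integral_Ioo, integral_Ioc_eq_integral_Ioo]
    refine setIntegral_congr_fun measurableSet_Ioo fun t ht => ?_
    rw [norm_mul, norm_mul, Complex.norm_cpow_eq_rpow_re_of_pos ht.1,
      Complex.norm_cpow_eq_rpow_re_of_pos ht.1]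
    simp
  have h3 := congrArg norm h1
  rw [norm_mul, norm_mul, Complex.Gamma_ofReal, Complex.norm_real, Real.norm_of_nonneg hΓ.le] at h3
  rw [div_mul_eq_mul_div, le_div_iff₀ hΓ, h3,
    show ((x : ℂ) + y * Complex.I + b) = x + b + y * Complex.I by ring, mul_comm]
  gcongr
  linarith

lemma norm_Gamma_nat_add_half_le (n : ℕ) : ∃ C : ℝ, 0 < C ∧ ∀ y : ℝ,
    ‖Complex.Gamma ((n + 1 / 2 : ℝ) + y * Complex.I)‖ ≤
      C * (1 + |y|) ^ n * Real.exp (-(Real.pi * |y| / 2)) := by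
  induction n with
  | zero =>
    refine ⟨√(2 * Real.pi), by positivity, fun y => ?_⟩
    have h1 := norm_Gamma_half y
    rw [← Real.cosh_abs, abs_mul, abs_of_pos Real.pi_pos] at h1
    rw [pow_zero, mul_one]
    refine le_of_sq_le_sq ?_ (by positivity)
    simp only [CharP.cast_eq_zero, zero_add]
    push_cast
    rw [h1, mul_pow, Real.sq_sqrt (by positivity), ← Real.exp_nat_mul,
      div_le_iff₀ (Real.cosh_pos _), Real.cosh_eq]
    have h2 : Real.exp ((2 : ℕ) * -(Real.pi * |y| / 2)) * Real.exp (Real.pi * |y|) = 1 := by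
      rw [← Real.exp_add, Real.exp_eq_one_iff]
      push_cast
      ring
    have h3 : 0 ≤ Real.exp ((2 : ℕ) * -(Real.pi * |y| / 2)) * Real.exp (-(Real.pi * |y|)) := by
      positivity
    nlinarith [Real.pi_pos]
  | succ n ih =>
    obtain ⟨C, hC, h⟩ := ih
    refine ⟨C * (n + 1), by positivity, fun y => ?_⟩
    have h1 : ((n + 1 / 2 : ℝ) : ℂ) + y * Complex.I ≠ 0 := by
      intro h0
      have := congrArg Complex.re h0
      simp at this
      have h2 : (0 : ℝ) < (n : ℝ) + 2⁻¹ := by positivity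
      linarith
    have h2 := Complex.Gamma_add_one _ h1
    have h3 : (((n + 1 : ℕ) + 1 / 2 : ℝ) : ℂ) + y * Complex.I =
        ((n + 1 / 2 : ℝ) : ℂ) + y * Complex.I + 1 := by
      push_cast
      ring
    have h4 : ‖((n + 1 / 2 : ℝ) : ℂ) + y * Complex.I‖ ≤ (n + 1) * (1 + |y|) := by
      refine (norm_add_le _ _).trans ?_
      rw [norm_mul, Complex.norm_I, Complex.norm_real, Complex.norm_real,
        Real.norm_of_nonneg (by positivity), Real.norm_eq_abs]
      have : (0 : ℝ) ≤ n * |y| := by positivity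
      nlinarith
    rw [h3, h2, norm_mul]
    calc _ ≤ ((n + 1) * (1 + |y|)) * (C * (1 + |y|) ^ n * Real.exp (-(Real.pi * |y| / 2))) := by
          gcongr
          exact h y
      _ = _ := by ring

lemma norm_Gamma_le {c : ℝ} (hc : 0 < c) : ∃ C : ℝ, 0 < C ∧ ∃ n : ℕ, ∀ y : ℝ,
    ‖Complex.Gamma (c + y * Complex.I)‖ ≤
      C * (1 + |y|) ^ n * Real.exp (-(Real.pi * |y| / 2)) := by
  obtain ⟨n, hn⟩ := exists_nat_gt c
  obtain ⟨C₁, hC₁, h₁⟩ := norm_Gamma_nat_add_half_le n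
  obtain ⟨C₂, hC₂, h₂⟩ := norm_Gamma_le_of_add hc (b := n + 1 / 2 - c) (by linarith)
  refine ⟨C₂ * C₁, by positivity, n, fun y => (h₂ y).trans ?_⟩
  have : (c : ℂ) + (n + 1 / 2 - c : ℝ) = (n + 1 / 2 : ℝ) := by push_cast; ring
  rw [this, mul_assoc, mul_assoc, ← mul_assoc C₁]
  gcongr
  exact h₁ y

lemma le_norm_Gamma {d : ℝ} (hd : 0 < d) : ∃ C : ℝ, 0 < C ∧ ∀ y : ℝ,
    Real.exp (-(Real.pi * |y| / 2)) ≤ C * (1 + |y|) * ‖Complex.Gamma (d + y * Complex.I)‖ := by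
  obtain ⟨C, hC, h⟩ := norm_Gamma_le_of_add (x := 1 / 2) (by norm_num) (b := d + 1 / 2) (by linarith)
  refine ⟨C * (d + 1), by positivity, fun y => ?_⟩
  have h1 : Real.exp (-(Real.pi * |y| / 2)) ≤ ‖Complex.Gamma (1 / 2 + y * Complex.I)‖ := by
    refine le_of_sq_le_sq ?_ (norm_nonneg _)
    rw [norm_Gamma_half, ← Real.cosh_abs, abs_mul, abs_of_pos Real.pi_pos,
      le_div_iff₀ (Real.cosh_pos _), ← Real.exp_nat_mul, Real.cosh_eq]
    have h2 : Real.exp ((2 : ℕ) * -(Real.pi * |y| / 2)) * Real.exp (Real.pi * |y|) = 1 := by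
      rw [← Real.exp_add, Real.exp_eq_one_iff]
      push_cast
      ring
    have h3 : Real.exp ((2 : ℕ) * -(Real.pi * |y| / 2)) * Real.exp (-(Real.pi * |y|)) ≤ 1 := by
      rw [← Real.exp_add, Real.exp_le_one_iff]
      push_cast
      have : 0 ≤ Real.pi * |y| := by positivity
      linarith
    linarith [Real.pi_gt_three]
  have h2 : (d : ℂ) + y * Complex.I ≠ 0 := by
    intro h0
    have := congrArg Complex.re h0
    simp at this
    linarith
  have h3 := h y
  rw [show (((1 / 2 : ℝ) : ℂ) + (d + 1 / 2 : ℝ) + y * Complex.I) = d + y * Complex.I + 1 by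
    push_cast; ring, Complex.Gamma_add_one _ h2, norm_mul] at h3
  push_cast at h3
  have h4 : ‖(d : ℂ) + y * Complex.I‖ ≤ (d + 1) * (1 + |y|) := by
    refine (norm_add_le _ _).trans ?_
    rw [norm_mul, Complex.norm_I, Complex.norm_real, Complex.norm_real,
      Real.norm_of_nonneg hd.le, Real.norm_eq_abs]
    have : (0 : ℝ) ≤ d * |y| := by positivity
    nlinarith
  calc _ ≤ C * (‖(d : ℂ) + y * Complex.I‖ * ‖Complex.Gamma (d + y * Complex.I)‖) := h1.trans h3
    _ ≤ C * (((d + 1) * (1 + |y|)) * ‖Complex.Gamma (d + y * Complex.I)‖) := by gcongr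
    _ = _ := by ring

/-- The Mellin transform of the density of the inverse stable subordinator. -/
noncomputable def gammaRatio (α : ℝ) (s : ℂ) : ℂ :=
  Complex.Gamma s / Complex.Gamma (1 - α + α * s)

lemma differentiableAt_gammaRatio (α : ℝ) {s : ℂ} (hs : 0 < s.re) :
    DifferentiableAt ℂ (gammaRatio α) s := by
  have h1 : DifferentiableAt ℂ Complex.Gamma s := by
    refine Complex.differentiableAt_Gamma s fun m hm => ?_
    rw [hm] at hs
    simp at hs
    exact absurd hs (by positivity : (0 : ℝ) ≤ m).not_gt
  have h2 : DifferentiableAt ℂ (fun s : ℂ => (Complex.Gamma (1 - α + α * s))⁻¹) s :=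
    (Complex.differentiable_one_div_Gamma _).comp s (f := fun s : ℂ => 1 - α + α * s)
      (by fun_prop)
  exact h1.mul h2

lemma pow_mul_exp_neg_le {δ : ℝ} (hδ : 0 < δ) (n : ℕ) : ∃ C : ℝ, ∀ y : ℝ,
    (1 + |y|) ^ n * Real.exp (-(δ * |y|)) ≤ C * (1 + y ^ 2)⁻¹ := by
  refine ⟨(n + 2).factorial * (δ⁻¹) ^ (n + 2) * Real.exp δ, fun y => ?_⟩
  have h1 := Real.pow_div_factorial_le_exp (δ * (1 + |y|)) (by positivity) (n + 2)
  rw [div_le_iff₀ (by positivity), mul_pow, mul_add, mul_one, Real.exp_add] at h1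
  have h2 : (1 + y ^ 2) ≤ (1 + |y|) ^ 2 := by
    have := sq_abs y
    nlinarith [abs_nonneg y]
  have h3 : δ ^ (n + 2) * (δ⁻¹) ^ (n + 2) = 1 := by
    rw [← mul_pow, mul_inv_cancel₀ hδ.ne', one_pow]
  have h4 : Real.exp (δ * |y|) * Real.exp (-(δ * |y|)) = 1 := by
    rw [← Real.exp_add]; simp
  rw [← div_eq_mul_inv, le_div_iff₀ (by positivity)]
  calc (1 + |y|) ^ n * Real.exp (-(δ * |y|)) * (1 + y ^ 2)
      ≤ (1 + |y|) ^ n * Real.exp (-(δ * |y|)) * (1 + |y|) ^ 2 := by gcongr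
    _ = (δ ^ (n + 2) * (1 + |y|) ^ (n + 2)) * (δ⁻¹ ^ (n + 2) * Real.exp (-(δ * |y|))) := by
      linear_combination (-(1 + |y|) ^ (n + 2) * Real.exp (-(δ * |y|))) * h3
    _ ≤ (Real.exp δ * Real.exp (δ * |y|) * (n + 2).factorial) *
        (δ⁻¹ ^ (n + 2) * Real.exp (-(δ * |y|))) := by gcongr
    _ = _ := by
      linear_combination (Real.exp δ * (n + 2).factorial * δ⁻¹ ^ (n + 2)) * h4

/-- Up to polynomial factors the numerator is at most `exp(-π|y|/2)` and the denominator at least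
`exp(-πα|y|/2)`; as `α < 1`, the ratio decays exponentially. -/
lemma integrable_gammaRatio {α : ℝ} (hα0 : 0 < α) (hα1 : α < 1) {c : ℝ} (hc : 0 < c) :
    Integrable fun y : ℝ => gammaRatio α (c + y * Complex.I) := by
  have hd : 0 < 1 - α + α * c := by nlinarith
  obtain ⟨C₁, hC₁, n, h₁⟩ := norm_Gamma_le hc
  obtain ⟨C₂, hC₂, h₂⟩ := le_norm_Gamma hd
  obtain ⟨C₃, h₃⟩ := pow_mul_exp_neg_le (δ := Real.pi * (1 - α) / 2)
    (by have := Real.pi_pos; have : 0 < 1 - α := by linarith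
        positivity) (n + 1)
  have hcont : Continuous fun y : ℝ => gammaRatio α (c + y * Complex.I) := by
    refine continuous_iff_continuousAt.2 fun y => ?_
    have h := (differentiableAt_gammaRatio α (s := c + y * Complex.I) (by simpa using hc)).continuousAt
    exact ContinuousAt.comp (f := fun y : ℝ => (c : ℂ) + y * Complex.I) h (by fun_prop)
  refine ((integrable_inv_one_add_sq.const_mul C₃).const_mul (C₁ * C₂)).mono'
    hcont.aestronglyMeasurable (Filter.Eventually.of_forall fun y => ?_)
  have h4 : (1 - α + α * (c + y * Complex.I) : ℂ) = (1 - α + α * c : ℝ) + (α * y : ℝ) * Complex.I := by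
    push_cast; ring
  have h5 := h₂ (α * y)
  rw [gammaRatio, norm_div, h4]
  have h6 : 0 < ‖Complex.Gamma ((1 - α + α * c : ℝ) + (α * y : ℝ) * Complex.I)‖ := by
    refine norm_pos_iff.2 (Complex.Gamma_ne_zero_of_re_pos ?_)
    simpa using hd
  set g := ‖Complex.Gamma ((1 - α + α * c : ℝ) + (α * y : ℝ) * Complex.I)‖
  rw [abs_mul, abs_of_pos hα0] at h5
  rw [div_le_iff₀ h6]
  have h7 : Real.exp (-(Real.pi * |y| / 2)) =
      Real.exp (-(Real.pi * (1 - α) / 2 * |y|)) * Real.exp (-(Real.pi * (α * |y|) / 2)) := by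
    rw [← Real.exp_add]; congr 1; ring
  have h8 : α * |y| ≤ |y| := by nlinarith [abs_nonneg y]
  calc _ ≤ C₁ * (1 + |y|) ^ n * Real.exp (-(Real.pi * |y| / 2)) := h₁ y
    _ = C₁ * (1 + |y|) ^ n * Real.exp (-(Real.pi * (1 - α) / 2 * |y|)) *
        Real.exp (-(Real.pi * (α * |y|) / 2)) := by rw [h7]; ring
    _ ≤ C₁ * (1 + |y|) ^ n * Real.exp (-(Real.pi * (1 - α) / 2 * |y|)) *
        (C₂ * (1 + |y|) * g) := by
      gcongr
      exact h5.trans (by gcongr)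
    _ = C₁ * C₂ * ((1 + |y|) ^ (n + 1) * Real.exp (-(Real.pi * (1 - α) / 2 * |y|))) * g := by ring
    _ ≤ C₁ * C₂ * (C₃ * (1 + y ^ 2)⁻¹) * g := by
      exact mul_le_mul_of_nonneg_right
        (mul_le_mul_of_nonneg_left (h₃ y) (by positivity)) h6.le

end SubordinatedBS

namespace SubordinatedBS

/-! ### Densities from integrable characteristic functions -/

section density

open scoped FourierTransform ContDiff

lemma charFun_neg_two_pi_mul (ρ : Measure ℝ) (ξ : ℝ) : charFun ρ (-(2 * Real.pi) * ξ) =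
    VectorFourier.fourierIntegral Real.fourierChar ρ (innerₗ ℝ) 1 ξ := by
  rw [charFun_eq_fourierIntegral']
  congr 1
  have := Real.pi_ne_zero
  simp only [smul_eq_mul]
  field_simp

/-- Parseval, used twice: the Fourier kernel is moved from the characteristic function onto `φ`, and
from `𝓕⁻ φ` onto `ρ`. -/
lemma integral_schwartzMap_eq {ρ : Measure ℝ} [IsProbabilityMeasure ρ]
    (h : Integrable (fun ξ : ℝ => charFun ρ (-(2 * Real.pi) * ξ))) (φ : SchwartzMap ℝ ℂ) :
    ∫ x, φ x * 𝓕⁻ (fun ξ : ℝ => charFun ρ (-(2 * Real.pi) * ξ)) x = ∫ x, φ x ∂ρ := by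
  have hc1 : Continuous fun p : ℝ × ℝ => (innerₗ ℝ p.1) p.2 := by
    simp only [innerₗ_apply_apply]
    fun_prop
  have hc2 : Continuous fun p : ℝ × ℝ => ((-innerₗ ℝ) p.1) p.2 := by
    simp only [LinearMap.neg_apply]
    exact hc1.neg
  have h1 := VectorFourier.integral_fourierIntegral_smul_eq_flip (μ := (volume : Measure ℝ))
    (ν := volume) (L := -innerₗ ℝ) (f := φ) (g := fun ξ : ℝ => charFun ρ (-(2 * Real.pi) * ξ))
    Real.continuous_fourierChar hc2 φ.integrable h
  have h2 := VectorFourier.integral_fourierIntegral_smul_eq_flip (μ := ρ)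
    (ν := volume) (L := innerₗ ℝ) (f := (1 : ℝ → ℂ)) (g := ⇑(𝓕⁻ φ : SchwartzMap ℝ ℂ))
    Real.continuous_fourierChar hc1 (integrable_const (1 : ℂ)) (𝓕⁻ φ : SchwartzMap ℝ ℂ).integrable
  have e1 : (-innerₗ ℝ : ℝ →ₗ[ℝ] ℝ →ₗ[ℝ] ℝ).flip = -innerₗ ℝ := by
    ext; simp
  have e2 : (innerₗ ℝ : ℝ →ₗ[ℝ] ℝ →ₗ[ℝ] ℝ).flip = innerₗ ℝ := by
    ext; simp
  rw [e1] at h1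
  rw [e2] at h2
  have e3 : VectorFourier.fourierIntegral Real.fourierChar volume (innerₗ ℝ)
      ⇑(𝓕⁻ φ : SchwartzMap ℝ ℂ) = φ := by
    have : 𝓕 (𝓕⁻ φ) = φ := FourierTransform.fourier_fourierInv_eq φ
    exact congrArg (fun ψ : SchwartzMap ℝ ℂ => (ψ : ℝ → ℂ)) this
  rw [e3] at h2
  simp only [Pi.one_apply, one_smul] at h2
  rw [← h2]
  refine h1.symm.trans (integral_congr_ae (Filter.Eventually.of_forall fun ξ => ?_))
  simp only [smul_eq_mul]
  rw [charFun_neg_two_pi_mul, mul_comm]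
  congr 1
  rw [SchwartzMap.fourierInv_coe]
  rfl

lemma nonneg_of_integral_bump_nonneg {f : ℝ → ℝ} (hf : Continuous f)
    (h : ∀ c : ℝ, ∀ φ : ContDiffBump c, 0 ≤ ∫ x, φ x * f x) (x : ℝ) : 0 ≤ f x := by
  by_contra! hx
  obtain ⟨ε, hε, hball⟩ := Metric.isOpen_iff.1 (isOpen_lt hf continuous_const) x hx
  let φ : ContDiffBump x := ⟨ε / 2, ε, by positivity, by linarith⟩
  have hle : ∀ y, φ y * f y ≤ 0 := fun y => by
    by_cases hy : y ∈ Metric.ball x ε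
    · exact mul_nonpos_of_nonneg_of_nonpos φ.nonneg (le_of_lt (hball hy))
    · rw [φ.zero_of_le_dist (by simpa using hy), zero_mul]
  have hcont : Continuous fun y => φ y * f y := φ.continuous.mul hf
  have hlt : 0 < ∫ y, -(φ y * f y) := by
    refine Continuous.integral_pos_of_hasCompactSupport_nonneg_nonzero hcont.neg ?_
      (fun y => neg_nonneg.2 (hle y)) (x := x) ?_
    · exact (φ.hasCompactSupport.mul_right).neg
    · rw [φ.one_of_mem_closedBall (Metric.mem_closedBall_self φ.rIn_pos.le)]
      simpa using hx.ne
  rw [integral_neg] at hlt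
  linarith [h x φ]

/-- Bumps that equal `1` on smaller closed balls and vanish off the open ball sandwich the two
measures; the smaller balls exhaust the ball. Exchanging the measures gives equality. -/
lemma measure_ball_le_of_bump {μ ν : Measure ℝ}
    (h : ∀ c : ℝ, ∀ φ : ContDiffBump c, ∫⁻ x, ENNReal.ofReal (φ x) ∂μ =
      ∫⁻ x, ENNReal.ofReal (φ x) ∂ν) (c : ℝ) {R : ℝ} (hR : 0 < R) :
    μ (Metric.ball c R) ≤ ν (Metric.ball c R) := by
  have hU : Metric.ball c R = ⋃ n : ℕ, Metric.closedBall c (R - R / (n + 2)) := by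
    ext x
    simp only [Metric.mem_ball, Set.mem_iUnion, Metric.mem_closedBall]
    constructor
    · intro hx
      obtain ⟨n, hn⟩ := exists_nat_gt (R / (R - dist x c))
      have h1 : 0 < R - dist x c := by linarith
      refine ⟨n, ?_⟩
      rw [div_lt_iff₀ h1] at hn
      have : R / ((n : ℝ) + 2) ≤ R - dist x c := by
        rw [div_le_iff₀ (by positivity)]
        nlinarith
      linarith
    · rintro ⟨n, hn⟩
      have : 0 < R / ((n : ℝ) + 2) := by positivity
      linarith
  have hmono : Monotone fun n : ℕ => Metric.closedBall c (R - R / (n + 2)) := by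
    intro n m hnm
    refine Metric.closedBall_subset_closedBall ?_
    gcongr
  rw [hU, hmono.measure_iUnion, ← hU]
  refine iSup_le fun n => ?_
  have hlt : R / ((n : ℝ) + 2) < R := div_lt_self hR (by linarith [n.cast_nonneg (α := ℝ)])
  let φ : ContDiffBump c := ⟨R - R / (n + 2), R, by linarith,
    sub_lt_self _ (by positivity)⟩
  calc μ (Metric.closedBall c (R - R / (n + 2)))
      = ∫⁻ x, (Metric.closedBall c (R - R / (n + 2))).indicator 1 x ∂μ := by
        rw [lintegral_indicator_one Metric.isClosed_closedBall.measurableSet]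
    _ ≤ ∫⁻ x, ENNReal.ofReal (φ x) ∂μ := by
        refine lintegral_mono fun x => ?_
        by_cases hx : x ∈ Metric.closedBall c (R - R / (n + 2))
        · rw [φ.one_of_mem_closedBall hx]; simp [hx]
        · simp [hx]
    _ = ∫⁻ x, ENNReal.ofReal (φ x) ∂ν := h c φ
    _ ≤ ∫⁻ x, (Metric.ball c R).indicator 1 x ∂ν := by
        refine lintegral_mono fun x => ?_
        by_cases hx : x ∈ Metric.ball c R
        · simpa [hx] using φ.le_one
        · rw [φ.zero_of_le_dist (by simpa using hx)]; simp
    _ = ν (Metric.ball c R) := by rw [lintegral_indicator_one Metric.isOpen_ball.measurableSet]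

/-- A probability measure with integrable characteristic function has a continuous density, given
by the inverse Fourier transform. -/
theorem exists_density_of_integrable_charFun {ρ : Measure ℝ} [IsProbabilityMeasure ρ]
    (h : Integrable (charFun ρ)) :
    ∃ f : ℝ → ℝ, Continuous f ∧ (∀ x, 0 ≤ f x) ∧
      ρ = volume.withDensity fun x => ENNReal.ofReal (f x) := by
  have hG : Integrable (fun ξ : ℝ => charFun ρ (-(2 * Real.pi) * ξ)) :=
    h.comp_mul_left' (by simp [Real.pi_ne_zero])
  set G : ℝ → ℂ := fun ξ => charFun ρ (-(2 * Real.pi) * ξ) with hGdef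
  have hFc : Continuous (𝓕⁻ G) := by
    refine VectorFourier.fourierIntegral_continuous Real.continuous_fourierChar ?_ hG
    simp only [LinearMap.neg_apply, innerₗ_apply_apply]
    fun_prop
  have hint (c : ℝ) (φ : ContDiffBump c) (f : ℝ → ℝ) (hf : Continuous f) :
      Integrable fun x => φ x * f x :=
    (φ.continuous.mul hf).integrable_of_hasCompactSupport φ.hasCompactSupport.mul_right
  have key (c : ℝ) (φ : ContDiffBump c) : ∫ x, φ x * (𝓕⁻ G x).re = ∫ x, φ x ∂ρ := by
    have hs : HasCompactSupport fun x => (φ x : ℂ) :=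
      φ.hasCompactSupport.comp_left (g := ((↑) : ℝ → ℂ)) (by simp)
    have hd : ContDiff ℝ ∞ fun x => (φ x : ℂ) :=
      Complex.ofRealCLM.contDiff.comp φ.contDiff
    have h1 := integral_schwartzMap_eq hG (hs.toSchwartzMap hd)
    have h2 : ∀ x, (hs.toSchwartzMap hd) x = (φ x : ℂ) := fun x => rfl
    simp only [h2] at h1
    rw [integral_complex_ofReal] at h1
    have h3 := congrArg Complex.re h1
    rw [Complex.ofReal_re] at h3
    rw [← h3]
    have h4 : Integrable fun x => (φ x : ℂ) * 𝓕⁻ G x :=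
      ((Complex.continuous_ofReal.comp φ.continuous).mul hFc).integrable_of_hasCompactSupport
        hs.mul_right
    rw [show (∫ x, (φ x : ℂ) * 𝓕⁻ G x).re = ∫ x, ((φ x : ℂ) * 𝓕⁻ G x).re from
      (integral_re h4).symm]
    simp
  have hre : Continuous fun x => (𝓕⁻ G x).re := Complex.continuous_re.comp hFc
  have hnn : ∀ x, 0 ≤ (𝓕⁻ G x).re := by
    refine nonneg_of_integral_bump_nonneg hre fun c φ => ?_
    rw [key]
    exact integral_nonneg fun x => φ.nonneg
  refine ⟨fun x => (𝓕⁻ G x).re, hre, hnn, ?_⟩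
  have hlint (c : ℝ) (φ : ContDiffBump c) : ∫⁻ x, ENNReal.ofReal (φ x) ∂ρ =
      ∫⁻ x, ENNReal.ofReal (φ x) ∂(volume.withDensity fun x => ENNReal.ofReal (𝓕⁻ G x).re) := by
    rw [lintegral_withDensity_eq_lintegral_mul _ hre.measurable.ennreal_ofReal
      φ.continuous.measurable.ennreal_ofReal]
    have h1 : Integrable φ ρ :=
      φ.continuous.integrable_of_hasCompactSupport φ.hasCompactSupport
    rw [← ofReal_integral_eq_lintegral_ofReal h1
      (Filter.Eventually.of_forall fun x => φ.nonneg), ← key,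
      ofReal_integral_eq_lintegral_ofReal (hint c φ _ hre)
      (Filter.Eventually.of_forall fun x => mul_nonneg φ.nonneg (hnn x))]
    refine lintegral_congr fun x => ?_
    rw [Pi.mul_apply, mul_comm, ENNReal.ofReal_mul (hnn x)]
  refine Real.measure_ext_Ioo_rat fun a b => ?_
  rcases lt_or_ge (a : ℝ) b with hab | hab
  · rw [Real.Ioo_eq_ball]
    have hR : 0 < ((b : ℝ) - a) / 2 := by linarith
    exact le_antisymm (measure_ball_le_of_bump hlint _ hR)
      (measure_ball_le_of_bump (fun c φ => (hlint c φ).symm) _ hR)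
  · simp [Set.Ioo_eq_empty_of_le hab]

end density

end SubordinatedBS

namespace SubordinatedBS

/-! ### Moments of positive stable laws -/

section stable

variable {ρ : Measure ℝ} {α x : ℝ}

/-- `ρ` is a law on `(0, ∞)` with Laplace transform `exp (-x u ^ α)`. -/
structure IsPositiveStable (α x : ℝ) (ρ : Measure ℝ) : Prop where
  ae_pos : ∀ᵐ v ∂ρ, 0 < v
  laplace : ∀ u : ℝ, 0 < u → ∫ v, Real.exp (-(u * v)) ∂ρ = Real.exp (-(x * u ^ α))

lemma IsPositiveStable.integrable_exp (h : IsPositiveStable α x ρ) {u : ℝ} (hu : 0 < u) :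
    Integrable (fun v => Real.exp (-(u * v))) ρ := by
  by_contra hcon
  have := h.laplace u hu
  rw [integral_undef hcon] at this
  exact (Real.exp_pos _).ne this

/-- Write `v^(-q)` as `Γ(q)⁻¹ ∫ u^(q-1) exp(-u v) du` and exchange the integrals: the Laplace
transform appears and leaves another Gamma integral. -/
lemma IsPositiveStable.lintegral_rpow_neg [IsProbabilityMeasure ρ] (h : IsPositiveStable α x ρ)
    (hα : 0 < α) (hx : 0 < x) {q : ℝ} (hq : 0 < q) :
    ∫⁻ v, ENNReal.ofReal (v ^ (-q)) ∂ρ =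
      ENNReal.ofReal (x ^ (-(q / α)) * (1 / α) * Real.Gamma (q / α) / Real.Gamma q) := by
  have hΓ := Real.Gamma_pos_of_pos hq
  have hint (v : ℝ) (hv : 0 < v) : IntegrableOn
      (fun u : ℝ => u ^ (q - 1) * Real.exp (-(u * v))) (Set.Ioi 0) := by
    have := integrableOn_rpow_mul_exp_neg_mul_rpow (s := q - 1) (p := 1) (by linarith) one_pos hv
    refine this.congr_fun (fun u _ => ?_) measurableSet_Ioi
    simp only [Real.rpow_one]
    congr 2
    ring
  have h1 : ∀ᵐ v ∂ρ, ENNReal.ofReal (v ^ (-q)) = ENNReal.ofReal (Real.Gamma q)⁻¹ *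
      ∫⁻ u in Set.Ioi (0 : ℝ), ENNReal.ofReal (u ^ (q - 1) * Real.exp (-(u * v))) := by
    filter_upwards [h.ae_pos] with v hv
    have h2 := Real.integral_rpow_mul_exp_neg_mul_Ioi hq hv
    rw [← ofReal_integral_eq_lintegral_ofReal (hint v hv), ← ENNReal.ofReal_mul (by positivity)]
    · congr 1
      have h3 : ∫ u in Set.Ioi (0 : ℝ), u ^ (q - 1) * Real.exp (-(u * v)) =
          ∫ u in Set.Ioi (0 : ℝ), u ^ (q - 1) * Real.exp (-(v * u)) := by
        simp only [mul_comm]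
      rw [h3, h2, one_div, Real.inv_rpow hv.le, Real.rpow_neg hv.le]
      field_simp
    · filter_upwards [ae_restrict_mem measurableSet_Ioi] with u hu
      exact mul_nonneg (Real.rpow_nonneg (le_of_lt hu) _) (Real.exp_pos _).le
  rw [lintegral_congr_ae h1, lintegral_const_mul _ (by fun_prop), lintegral_lintegral_swap
    (by fun_prop)]
  have h2 : ∀ u ∈ Set.Ioi (0 : ℝ), ∫⁻ v, ENNReal.ofReal (u ^ (q - 1) * Real.exp (-(u * v))) ∂ρ =
      ENNReal.ofReal (u ^ (q - 1) * Real.exp (-x * u ^ α)) := by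
    intro u hu
    have hu' : 0 < u := hu
    rw [neg_mul, ← h.laplace u hu, ← integral_const_mul, ofReal_integral_eq_lintegral_ofReal
      ((h.integrable_exp hu).const_mul _) (Filter.Eventually.of_forall fun v => by
        dsimp only [Pi.zero_apply]; positivity)]
  rw [setLIntegral_congr_fun measurableSet_Ioi h2, ← ofReal_integral_eq_lintegral_ofReal
    (integrableOn_rpow_mul_exp_neg_mul_rpow (by linarith) hα hx),
    integral_rpow_mul_exp_neg_mul_rpow hα (by linarith) hx, ← ENNReal.ofReal_mul (by positivity)]
  · congr 1
    rw [sub_add_cancel, neg_div]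
    ring
  · filter_upwards [ae_restrict_mem measurableSet_Ioi] with u hu
    exact mul_nonneg (Real.rpow_nonneg (le_of_lt hu) _) (Real.exp_pos _).le

/-- For `v ≥ t` one has `1 - exp(-v/t) ≥ 1 - exp(-1)`, while the expectation of the left side is `1
- exp(-x t^(-α)) ≤ x t^(-α)`. -/
lemma IsPositiveStable.measureReal_Ici_le [IsProbabilityMeasure ρ] (h : IsPositiveStable α x ρ)
    {t : ℝ} (ht : 0 < t) :
    ρ.real (Set.Ici t) ≤ (1 - Real.exp (-1))⁻¹ * x * t ^ (-α) := by
  have he : 0 < 1 - Real.exp (-1) := by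
    rw [sub_pos, Real.exp_lt_one_iff]
    norm_num
  have h0 : (1 - Real.exp (-1)) * ρ.real (Set.Ici t) ≤ x * t ^ (-α) := by
    have h1 : (1 - Real.exp (-1)) * ρ.real (Set.Ici t) =
        ∫ v, (Set.Ici t).indicator (fun _ => 1 - Real.exp (-1)) v ∂ρ := by
      rw [integral_indicator measurableSet_Ici]
      simp [mul_comm]
    have h2 : ∫ v, (1 - Real.exp (-(t⁻¹ * v))) ∂ρ = 1 - Real.exp (-(x * t ^ (-α))) := by
      rw [integral_sub (integrable_const _) (h.integrable_exp (inv_pos.2 ht)),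
        h.laplace _ (inv_pos.2 ht), Real.inv_rpow ht.le, Real.rpow_neg ht.le]
      simp
    have h3 := Real.add_one_le_exp (-(x * t ^ (-α)))
    refine le_trans ?_ (show 1 - Real.exp (-(x * t ^ (-α))) ≤ _ by linarith)
    rw [h1, ← h2]
    refine integral_mono_ae ((integrable_const _).indicator measurableSet_Ici)
      ((integrable_const _).sub (h.integrable_exp (inv_pos.2 ht))) ?_
    filter_upwards [h.ae_pos] with v hv
    by_cases hvt : v ∈ Set.Ici t
    · have hvt' : t ≤ v := hvt
      rw [Set.indicator_of_mem hvt, sub_le_sub_iff_left, Real.exp_le_exp, neg_le_neg_iff,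
        inv_mul_eq_div, le_div_iff₀ ht]
      linarith
    · rw [Set.indicator_of_notMem hvt, sub_nonneg, Real.exp_le_one_iff, neg_nonpos]
      positivity
  rw [mul_assoc, inv_mul_eq_div, le_div_iff₀ he]
  linarith

lemma IsPositiveStable.integrable_rpow [IsProbabilityMeasure ρ] (h : IsPositiveStable α x ρ)
    (hx : 0 < x) {q : ℝ} (hq : 0 < q) (hqα : q < α) : Integrable (fun v => v ^ q) ρ := by
  have he : 0 < 1 - Real.exp (-1) := by
    rw [sub_pos, Real.exp_lt_one_iff]
    norm_num
  refine ⟨by fun_prop, ?_⟩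
  rw [hasFiniteIntegral_iff_ofReal (by
    filter_upwards [h.ae_pos] with v hv using Real.rpow_nonneg hv.le q),
    lintegral_rpow_eq_lintegral_meas_le_mul ρ (f := fun v => v)
      (by filter_upwards [h.ae_pos] with v hv using hv.le) (by fun_prop) hq]
  refine ENNReal.mul_lt_top ENNReal.ofReal_lt_top ?_
  rw [← Set.Ioc_union_Ioi_eq_Ioi (zero_le_one (α := ℝ)), lintegral_union measurableSet_Ioi
    (Set.Ioc_disjoint_Ioi_same)]
  refine ENNReal.add_lt_top.2 ⟨?_, ?_⟩
  · have h1 : IntegrableOn (fun t : ℝ => t ^ (q - 1)) (Set.Ioc 0 1) :=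
      (intervalIntegrable_iff_integrableOn_Ioc_of_le zero_le_one).1
        (intervalIntegral.intervalIntegrable_rpow' (by linarith))
    refine lt_of_le_of_lt (lintegral_mono fun t => ?_)
      ((hasFiniteIntegral_iff_ofReal ?_).1 h1.2)
    · exact (mul_le_mul_left prob_le_one _).trans (one_mul _).le
    · filter_upwards [ae_restrict_mem measurableSet_Ioc] with t ht
      exact Real.rpow_nonneg ht.1.le _
  · have h1 : IntegrableOn (fun t : ℝ => (1 - Real.exp (-1))⁻¹ * x * t ^ (q - 1 - α))
        (Set.Ioi 1) :=
      (integrableOn_Ioi_rpow_of_lt (by linarith) one_pos).const_mul _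
    refine lt_of_le_of_lt (setLIntegral_mono' measurableSet_Ioi fun t ht => ?_)
      ((hasFiniteIntegral_iff_ofReal ?_).1 h1.2)
    · have ht' : 0 < t := one_pos.trans ht
      have h2 := h.measureReal_Ici_le ht'
      have h3 : ρ {a | t ≤ a} = ENNReal.ofReal (ρ.real (Set.Ici t)) :=
        (ofReal_measureReal (measure_ne_top _ _)).symm
      rw [h3, ← ENNReal.ofReal_mul measureReal_nonneg]
      refine ENNReal.ofReal_le_ofReal ((mul_le_mul_of_nonneg_right h2
        (Real.rpow_nonneg ht'.le _)).trans (le_of_eq ?_))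
      rw [mul_assoc, ← Real.rpow_add ht']
      congr 2
      ring
    · filter_upwards [ae_restrict_mem measurableSet_Ioi] with t ht
      have ht' : (0 : ℝ) < t := one_pos.trans ht
      dsimp only [Pi.zero_apply]
      positivity

/-- The logarithm of `x v ^ (-α)`. -/
noncomputable def logScaled (α x v : ℝ) : ℝ := Real.log x - α * Real.log v

lemma measurable_logScaled (α x : ℝ) : Measurable (logScaled α x) := by
  unfold logScaled
  fun_prop

lemma exp_mul_logScaled (hx : 0 < x) {v : ℝ} (hv : 0 < v) (p : ℝ) :
    Real.exp (p * logScaled α x v) = x ^ p * v ^ (-(α * p)) := by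
  rw [Real.rpow_def_of_pos hx, Real.rpow_def_of_pos hv, ← Real.exp_add, logScaled]
  congr 1
  ring

/-- The moment involved has order `-α p`: below `α` exactly when `p > -1`, which the tail bound
allows, and negative for `p > 0`, where it is explicit. -/
lemma IsPositiveStable.integrable_exp_mul_logScaled [IsProbabilityMeasure ρ]
    (h : IsPositiveStable α x ρ) (hα : 0 < α) (hx : 0 < x) {p : ℝ} (hp : -1 < p) :
    Integrable (fun v => Real.exp (p * logScaled α x v)) ρ := by
  have hae : (fun v => Real.exp (p * logScaled α x v)) =ᵐ[ρ] fun v => x ^ p * v ^ (-(α * p)) := by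
    filter_upwards [h.ae_pos] with v hv using exp_mul_logScaled hx hv p
  refine Integrable.congr (Integrable.const_mul ?_ _) hae.symm
  rcases lt_trichotomy p 0 with hp0 | rfl | hp0
  · exact h.integrable_rpow hx (by nlinarith) (by nlinarith)
  · simp
  · refine ⟨by fun_prop, ?_⟩
    rw [hasFiniteIntegral_iff_ofReal (by
      filter_upwards [h.ae_pos] with v hv using Real.rpow_nonneg hv.le _),
      h.lintegral_rpow_neg hα hx (by positivity)]
    exact ENNReal.ofReal_lt_top

lemma IsPositiveStable.mgf_logScaled [IsProbabilityMeasure ρ]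
    (h : IsPositiveStable α x ρ) (hα : 0 < α) (hx : 0 < x) {p : ℝ} (hp : 0 < p) :
    mgf (logScaled α x) ρ p = Real.Gamma (1 + p) / Real.Gamma (1 + α * p) := by
  have hae : (fun v => Real.exp (p * logScaled α x v)) =ᵐ[ρ] fun v => x ^ p * v ^ (-(α * p)) := by
    filter_upwards [h.ae_pos] with v hv using exp_mul_logScaled hx hv p
  have hΓ := Real.Gamma_pos_of_pos (mul_pos hα hp)
  have hΓ2 := Real.Gamma_pos_of_pos hp
  rw [mgf, integral_congr_ae hae, integral_const_mul, integral_eq_lintegral_of_nonneg_ae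
    (by filter_upwards [h.ae_pos] with v hv using Real.rpow_nonneg hv.le _) (by fun_prop),
    h.lintegral_rpow_neg hα hx (by positivity), mul_div_cancel_left₀ _ hα.ne',
    ENNReal.toReal_ofReal (by positivity), add_comm 1 p, add_comm 1 (α * p),
    Real.Gamma_add_one hp.ne', Real.Gamma_add_one (by positivity), Real.rpow_neg hx.le]
  have := Real.rpow_pos_of_pos hx p
  field_simp

/-- Both sides are analytic on `Re z > -1` and agree for real `z > 0`, a set accumulating at `1`;
the identity theorem does the rest. -/
lemma IsPositiveStable.complexMGF_logScaled [IsProbabilityMeasure ρ]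
    (h : IsPositiveStable α x ρ) (hα : 0 < α) (hx : 0 < x) {z : ℂ} (hz : -1 < z.re) :
    complexMGF (logScaled α x) ρ z = gammaRatio α (1 + z) := by
  have hsub : Set.Ioi (-1) ⊆ interior (integrableExpSet (logScaled α x) ρ) :=
    interior_maximal (fun p hp => h.integrable_exp_mul_logScaled hα hx hp) isOpen_Ioi
  have hopen : IsOpen {z : ℂ | -1 < z.re} := isOpen_lt continuous_const Complex.continuous_re
  have h1 : AnalyticOnNhd ℂ (complexMGF (logScaled α x) ρ) {z : ℂ | -1 < z.re} :=
    analyticOnNhd_complexMGF.mono fun z hz => hsub hz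
  have h2 : AnalyticOnNhd ℂ (fun z => gammaRatio α (1 + z)) {z : ℂ | -1 < z.re} := by
    refine DifferentiableOn.analyticOnNhd (fun z hz => ?_) hopen
    have hz' : -1 < z.re := hz
    have h3 := differentiableAt_gammaRatio α (s := 1 + z) (by simp; linarith)
    exact (h3.comp z (by fun_prop)).differentiableWithinAt
  have hconn : IsPreconnected {z : ℂ | -1 < z.re} := (convex_halfSpace_re_gt (-1)).isPreconnected
  have hfreq : ∃ᶠ z in nhdsWithin (1 : ℂ) {1}ᶜ,
      complexMGF (logScaled α x) ρ z = gammaRatio α (1 + z) := by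
    have ht : Filter.Tendsto (fun p : ℝ => (p : ℂ)) (nhdsWithin 1 {1}ᶜ)
        (nhdsWithin (1 : ℂ) {1}ᶜ) := by
      refine tendsto_nhdsWithin_of_tendsto_nhds_of_eventually_within _ ?_ ?_
      · exact (Complex.continuous_ofReal.tendsto' 1 1 (by simp)).mono_left nhdsWithin_le_nhds
      · filter_upwards [self_mem_nhdsWithin] with p hp
        simpa using hp
    refine ht.frequently (Filter.Eventually.frequently ?_)
    filter_upwards [mem_nhdsWithin_of_mem_nhds (Ioi_mem_nhds (zero_lt_one (α := ℝ)))] with p hp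
    have hp' : 0 < p := hp
    rw [complexMGF_ofReal, h.mgf_logScaled hα hx hp, gammaRatio, Complex.ofReal_div,
      ← Complex.Gamma_ofReal, ← Complex.Gamma_ofReal]
    congr 2
    · push_cast; ring
    · push_cast; ring
  exact h1.eqOn_of_preconnected_of_frequently_eq h2 hconn
    (show -1 < (1 : ℂ).re by simp) hfreq hz

end stable

end SubordinatedBS

namespace SubordinatedBS

/-! ### The density of the inverse stable law and its Mellin transform -/

section density

variable {ρ ρ' : Measure ℝ} {α x x' : ℝ}

lemma IsPositiveStable.charFun_map_logScaled [IsProbabilityMeasure ρ]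
    (h : IsPositiveStable α x ρ) (hα : 0 < α) (hx : 0 < x) (t : ℝ) :
    charFun (ρ.map (logScaled α x)) t = gammaRatio α (1 + t * Complex.I) := by
  rw [← complexMGF_mul_I (measurable_logScaled α x).aemeasurable,
    h.complexMGF_logScaled hα hx (by simp)]

/-- Self-similarity: the characteristic function of the logarithm of `x V^(-α)` does not involve
`x`. -/
lemma IsPositiveStable.map_logScaled_eq [IsProbabilityMeasure ρ] [IsProbabilityMeasure ρ']
    (h : IsPositiveStable α x ρ) (h' : IsPositiveStable α x' ρ') (hα : 0 < α) (hx : 0 < x)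
    (hx' : 0 < x') : ρ.map (logScaled α x) = ρ'.map (logScaled α x') := by
  refine Measure.ext_of_charFun (funext fun t => ?_)
  rw [h.charFun_map_logScaled hα hx, h'.charFun_map_logScaled hα hx']

lemma IsPositiveStable.exists_density_map_logScaled [IsProbabilityMeasure ρ]
    (h : IsPositiveStable α x ρ) (hα : 0 < α) (hα1 : α < 1) (hx : 0 < x) :
    ∃ f : ℝ → ℝ, Continuous f ∧ (∀ y, 0 ≤ f y) ∧
      ρ.map (logScaled α x) = volume.withDensity fun y => ENNReal.ofReal (f y) := by
  have : IsProbabilityMeasure (ρ.map (logScaled α x)) :=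
    Measure.isProbabilityMeasure_map (measurable_logScaled α x).aemeasurable
  refine exists_density_of_integrable_charFun ?_
  have h1 := integrable_gammaRatio hα hα1 one_pos
  refine h1.congr (Filter.Eventually.of_forall fun t => ?_)
  rw [h.charFun_map_logScaled hα hx]
  simp

lemma hasDerivWithinAt_const_mul_exp (a y : ℝ) (s : Set ℝ) :
    HasDerivWithinAt (fun y => a * Real.exp y) (a * Real.exp y) s y :=
  ((Real.hasDerivAt_exp y).const_mul a).hasDerivWithinAt

lemma injective_const_mul_exp {a : ℝ} (ha : a ≠ 0) :
    Function.Injective fun y => a * Real.exp y := fun _ _ h =>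
  Real.exp_injective (mul_left_cancel₀ ha h)

lemma image_exp_univ : (fun y => 1 * Real.exp y) '' Set.univ = Set.Ioi 0 := by
  simp [Set.image_univ, Real.range_exp]

/-- The substitution `z = exp y` turns the Mellin transform at `s` into the exponential moment of
order `s - 1` of the density `f`. -/
lemma mellin_integrand_exp (f : ℝ → ℝ) (s : ℂ) (y : ℝ) :
    |1 * Real.exp y| • (((1 * Real.exp y : ℝ) : ℂ) ^ (s - 1) •
      ((f (Real.log (1 * Real.exp y)) / (1 * Real.exp y) : ℝ) : ℂ)) =
    f y • Complex.exp ((s - 1) * y) := by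
  rw [one_mul, abs_of_pos (Real.exp_pos y), Real.log_exp, Complex.ofReal_exp,
    Complex.cpow_def_of_ne_zero (Complex.exp_ne_zero _),
    Complex.log_exp (by simp [Real.pi_pos]) (by simpa using Real.pi_pos.le)]
  simp only [Complex.real_smul, smul_eq_mul, Complex.ofReal_div, Complex.ofReal_exp]
  have := Complex.exp_ne_zero (y : ℂ)
  field_simp

variable {f : ℝ → ℝ}

lemma IsPositiveStable.mellin_density [IsProbabilityMeasure ρ]
    (h : IsPositiveStable α x ρ) (hα : 0 < α) (hx : 0 < x) (hf : Continuous f)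
    (hf0 : ∀ y, 0 ≤ f y)
    (hρ : ρ.map (logScaled α x) = volume.withDensity fun y => ENNReal.ofReal (f y))
    {s : ℂ} (hs : 0 < s.re) :
    MellinConvergent (fun z => ((f (Real.log z) / z : ℝ) : ℂ)) s ∧
      mellin (fun z => ((f (Real.log z) / z : ℝ) : ℂ)) s = gammaRatio α s := by
  have hlog := (measurable_logScaled α x).aemeasurable (μ := ρ)
  have hs' : -1 < (s - 1).re := by simpa using hs
  have hmeas : Measurable fun y => ENNReal.ofReal (f y) := hf.measurable.ennreal_ofReal
  have htop : ∀ᵐ y : ℝ, ENNReal.ofReal (f y) < ∞ :=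
    Filter.Eventually.of_forall fun y => ENNReal.ofReal_lt_top
  constructor
  · rw [MellinConvergent, ← image_exp_univ, integrableOn_image_iff_integrableOn_abs_deriv_smul
      MeasurableSet.univ (fun y _ => hasDerivWithinAt_const_mul_exp 1 y _)
      (injective_const_mul_exp one_ne_zero).injOn]
    simp only [mellin_integrand_exp, integrableOn_univ]
    have h1 : Integrable (fun y : ℝ => Complex.exp ((s - 1) * y)) (ρ.map (logScaled α x)) := by
      rw [integrable_map_measure (by fun_prop) hlog, ← integrable_norm_iff
        (((by fun_prop : Measurable fun y : ℝ => Complex.exp ((s - 1) * y)).comp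
          (measurable_logScaled α x)).aestronglyMeasurable)]
      refine (h.integrable_exp_mul_logScaled hα hx hs').congr
        (Filter.Eventually.of_forall fun v => ?_)
      simp [Complex.norm_exp]
    rw [hρ, integrable_withDensity_iff_integrable_smul' hmeas htop] at h1
    simpa only [ENNReal.toReal_ofReal (hf0 _)] using h1
  · rw [mellin, ← image_exp_univ, integral_image_eq_integral_abs_deriv_smul
      MeasurableSet.univ (fun y _ => hasDerivWithinAt_const_mul_exp 1 y _)
      (injective_const_mul_exp one_ne_zero).injOn]
    simp only [mellin_integrand_exp, setIntegral_univ]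
    have h1 := h.complexMGF_logScaled hα hx hs'
    rw [add_sub_cancel, ← complexMGF_id_map hlog, complexMGF, hρ,
      integral_withDensity_eq_integral_toReal_smul hmeas htop] at h1
    simpa only [ENNReal.toReal_ofReal (hf0 _), id] using h1

/-- Mellin inversion: with these parameters the kernel is `Γ(s)/Γ(1-α+αs)`, the Mellin transform
just found. Every `c > 0` is allowed because that transform exists and is integrable on each such
line. -/
lemma IsPositiveStable.density_eq_foxH [IsProbabilityMeasure ρ]
    (h : IsPositiveStable α x ρ) (hα : 0 < α) (hα1 : α < 1) (hx : 0 < x) (hf : Continuous f)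
    (hf0 : ∀ y, 0 ≤ f y)
    (hρ : ρ.map (logScaled α x) = volume.withDensity fun y => ENNReal.ofReal (f y))
    {c z : ℝ} (hc : 0 < c) (hz : 0 < z) :
    ((f (Real.log z) / z : ℝ) : ℂ) = foxH 1 0 ![1 - α] ![α] ![0] ![1] c z := by
  have hm (y : ℝ) := h.mellin_density hα hx hf hf0 hρ (s := c + y * Complex.I) (by simpa using hc)
  have hker (y : ℝ) : foxHKernel 1 0 ![1 - α] ![α] ![0] ![1] (c + y * Complex.I) =
      mellin (fun z => ((f (Real.log z) / z : ℝ) : ℂ)) (c + y * Complex.I) := by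
    rw [(hm y).2, gammaRatio]
    simp [foxHKernel]
  have hinv := mellinInv_mellin_eq c (fun z => ((f (Real.log z) / z : ℝ) : ℂ)) hz
    (by simpa using (hm 0).1)
    (by
      refine (integrable_gammaRatio hα hα1 hc).congr (Filter.Eventually.of_forall fun y => ?_)
      exact (hm y).2.symm)
    (by
      refine Complex.continuous_ofReal.continuousAt.comp (ContinuousAt.div ?_ continuousAt_id hz.ne')
      exact hf.continuousAt.comp (Real.continuousAt_log hz.ne'))
  rw [← hinv, foxH, mellinInv, mellinInv]
  simp only [hker]

lemma map_const_mul_exp_withDensity (f : ℝ → ℝ) {a : ℝ} (ha : 0 < a) :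
    (volume.withDensity fun y => ENNReal.ofReal (f y)).map (fun y => a * Real.exp y) =
      (volume.restrict (Set.Ioi 0)).withDensity fun y =>
        ENNReal.ofReal (a⁻¹ * (f (Real.log (y / a)) / (y / a))) := by
  have hφ : Measurable fun y => a * Real.exp y := by fun_prop
  ext s hs
  rw [Measure.map_apply hφ hs, withDensity_apply _ (hφ hs), withDensity_apply _ hs,
    Measure.restrict_restrict hs]
  have himg : s ∩ Set.Ioi 0 = (fun y => a * Real.exp y) '' ((fun y => a * Real.exp y) ⁻¹' s) := by
    rw [Set.image_preimage_eq_inter_range]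
    congr 1
    ext y
    constructor
    · intro hy
      have hy' : 0 < y := hy
      exact ⟨Real.log (y / a), by
        dsimp only
        rw [Real.exp_log (by positivity)]
        field_simp⟩
    · rintro ⟨u, rfl⟩
      exact mul_pos ha (Real.exp_pos u)
  rw [himg, lintegral_image_eq_lintegral_abs_deriv_mul (hφ hs)
    (fun y _ => hasDerivWithinAt_const_mul_exp a y _) (injective_const_mul_exp ha.ne').injOn]
  refine lintegral_congr fun y => ?_
  have he := Real.exp_pos y
  rw [← ENNReal.ofReal_mul (abs_nonneg _), abs_of_pos (by positivity),
    mul_div_cancel_left₀ _ ha.ne', Real.log_exp]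
  congr 1
  field_simp

end density

/-! ### Laws determined by interlaced distribution functions -/

/-- Right continuity of one distribution function and the absence of atoms close the gap between the
strict and weak inequalities. -/
lemma eq_of_forall_measure_Iio_le {m₁ m₂ : Measure ℝ} [IsProbabilityMeasure m₁]
    [IsProbabilityMeasure m₂] [NullSingletonClass m₂] (h₁ : m₁ (Set.Iio 0) = 0) (h₂ : m₂ (Set.Iic 0) = 0)
    (hle : ∀ x, 0 < x → m₁ (Set.Iio x) ≤ m₂ (Set.Iio x))
    (hge : ∀ x, 0 < x → m₂ (Set.Iio x) ≤ m₁ (Set.Iic x)) : m₁ = m₂ := by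
  refine Measure.eq_of_cdf _ _ (StieltjesFunction.ext fun x => ?_)
  rcases lt_or_ge x 0 with hx | hx
  · rw [cdf_eq_real, cdf_eq_real, measureReal_def, measureReal_def,
      measure_mono_null (Set.Iic_subset_Iio.2 hx) h₁,
      measure_mono_null (Set.Iic_subset_Iic.2 hx.le) h₂]
  apply le_antisymm
  · have hcont := (cdf m₂).right_continuous x
    have ht : Filter.Tendsto (cdf m₂) (nhdsWithin x (Set.Ioi x)) (nhds (cdf m₂ x)) :=
      hcont.tendsto.mono_left (nhdsWithin_mono _ Set.Ioi_subset_Ici_self)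
    refine ge_of_tendsto ht ?_
    filter_upwards [self_mem_nhdsWithin] with y hy
    have hy' : x < y := hy
    rw [cdf_eq_real, cdf_eq_real]
    refine ENNReal.toReal_mono (measure_ne_top _ _) ?_
    calc m₁ (Set.Iic x) ≤ m₁ (Set.Iio y) := measure_mono (Set.Iic_subset_Iio.2 hy')
      _ ≤ m₂ (Set.Iio y) := hle y (hx.trans_lt hy')
      _ ≤ m₂ (Set.Iic y) := measure_mono Set.Iio_subset_Iic_self
  · rw [cdf_eq_real, cdf_eq_real]
    refine ENNReal.toReal_mono (measure_ne_top _ _) ?_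
    rcases eq_or_lt_of_le hx with rfl | hx
    · rw [h₂]
      exact zero_le
    · rw [← measure_congr (Iio_ae_eq_Iic (μ := m₂))]
      exact hge x hx

/-! ### The law of the inverse stable subordinator -/

variable {Ω : Type*} {mΩ : MeasurableSpace Ω} {P : Measure Ω} {U : ℝ≥0 → Ω → ℝ} {ν : Measure ℝ}
  {α : ℝ}

lemma IsSubordinator.isPositiveStable [IsProbabilityMeasure P] (hU : IsSubordinator U ν P)
    (hν : IsInfiniteLevyMeasure ν) (hψ : ∀ u : ℝ, 0 < u → laplaceExponent ν u = u ^ α)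
    {x : ℝ≥0} (hx : 0 < x) : IsPositiveStable α x (P.map (U x)) where
  ae_pos := (ae_map_iff (hU.aemeasurable x) measurableSet_Ioi).2 (hU.ae_pos hν hx)
  laplace u hu := by
    rw [integral_map (hU.aemeasurable x) (by fun_prop), hU.laplace x u hu, hψ u hu]

/-- `S(T) < x` implies `U(x) > T`, which implies `S(T) ≤ x`; by self-similarity the middle event has
the probability of `T^α U(1)^(-α) < x`. -/
lemma IsSubordinator.map_inverse_eq [IsProbabilityMeasure P] (hU : IsSubordinator U ν P)
    (hν : IsInfiniteLevyMeasure ν) (hα : 0 < α)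
    (hψ : ∀ u : ℝ, 0 < u → laplaceExponent ν u = u ^ α) {f : ℝ → ℝ}
    (hρ : (P.map (U 1)).map (logScaled α 1) = volume.withDensity fun y => ENNReal.ofReal (f y))
    {T : ℝ≥0} (hT : 0 < T) :
    P.map (fun ω => (inverseSubordinator U T ω : ℝ)) =
      (volume.restrict (Set.Ioi 0)).withDensity fun y => ENNReal.ofReal
        ((T : ℝ) ^ (-α) * (f (Real.log (y / (T : ℝ) ^ α)) / (y / (T : ℝ) ^ α))) := by
  have hT' : (0 : ℝ) < T := hT
  have hTα : 0 < (T : ℝ) ^ α := Real.rpow_pos_of_pos hT' α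
  rw [Real.rpow_neg hT'.le, ← map_const_mul_exp_withDensity f hTα]
  have hUp (x : ℝ≥0) : IsProbabilityMeasure (P.map (U x)) :=
    Measure.isProbabilityMeasure_map (hU.aemeasurable x)
  have hLp : IsProbabilityMeasure ((P.map (U 1)).map (logScaled α 1)) :=
    Measure.isProbabilityMeasure_map (measurable_logScaled α 1).aemeasurable
  rw [hρ] at hLp
  have hφ : Measurable fun y => (T : ℝ) ^ α * Real.exp y := by fun_prop
  have hS : AEMeasurable (fun ω => (inverseSubordinator U T ω : ℝ)) P :=
    (hU.aemeasurable_inverse hν T).coe_nnreal_real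
  have h1 := Measure.isProbabilityMeasure_map hS
  have h2 := Measure.isProbabilityMeasure_map hφ.aemeasurable
    (μ := volume.withDensity fun y => ENNReal.ofReal (f y))
  have hna : NullSingletonClass ((volume.withDensity fun y => ENNReal.ofReal (f y)).map
      fun y => (T : ℝ) ^ α * Real.exp y) := by
    rw [map_const_mul_exp_withDensity f hTα]
    infer_instance
  have hcdf (x : ℝ) (hx : 0 < x) : (volume.withDensity fun y => ENNReal.ofReal (f y)).map
      (fun y => (T : ℝ) ^ α * Real.exp y) (Set.Iio x) = P {ω | (T : ℝ) < U x.toNNReal ω} := by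
    have hx' : 0 < x.toNNReal := Real.toNNReal_pos.2 hx
    have hst := hU.isPositiveStable hν hψ hx'
    rw [Real.coe_toNNReal x hx.le] at hst
    have hst1 := hU.isPositiveStable hν hψ one_pos
    rw [NNReal.coe_one] at hst1
    -- Replacing `U(1)` by `U(x)` turns the event into `T^α x U(x)^(-α) < x`, that is `T < U(x)`.
    rw [← hρ, hst1.map_logScaled_eq hst hα one_pos hx, Measure.map_apply hφ measurableSet_Iio,
      Measure.map_apply (measurable_logScaled α x) (hφ measurableSet_Iio)]
    have hset : MeasurableSet (Set.Ioi (T : ℝ)) := measurableSet_Ioi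
    rw [show {ω | (T : ℝ) < U x.toNNReal ω} = U x.toNNReal ⁻¹' Set.Ioi (T : ℝ) from rfl,
      ← Measure.map_apply_of_aemeasurable (hU.aemeasurable _) hset]
    refine measure_congr ?_
    filter_upwards [hst.ae_pos] with v hv
    refine propext ?_
    change (T : ℝ) ^ α * Real.exp (logScaled α x v) < x ↔ (T : ℝ) < v
    have h3 := exp_mul_logScaled (α := α) hx hv 1
    rw [one_mul, Real.rpow_one, mul_one, Real.rpow_neg hv.le] at h3
    have hvα := Real.rpow_pos_of_pos hv α
    rw [h3, ← Real.rpow_lt_rpow_iff hT'.le hv.le hα, ← div_eq_mul_inv, mul_div_assoc',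
      div_lt_iff₀ hvα, mul_comm x, mul_lt_mul_iff_left₀ hx]
  refine eq_of_forall_measure_Iio_le ?_ ?_ (fun x hx => ?_) (fun x hx => ?_)
  · rw [Measure.map_apply_of_aemeasurable hS measurableSet_Iio]
    convert measure_empty (μ := P)
    ext ω
    simp
  · rw [Measure.map_apply hφ measurableSet_Iic]
    convert measure_empty (μ := volume.withDensity fun y => ENNReal.ofReal (f y))
    ext y
    have : 0 < (T : ℝ) ^ α * Real.exp y := by positivity
    simpa using this
  · rw [hcdf x hx, Measure.map_apply_of_aemeasurable hS measurableSet_Iio]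
    refine measure_mono_ae ?_
    filter_upwards [hU.ae_isRegularPath hν] with ω hω hlt
    exact lt_of_inverseSubordinator_lt hω (Real.lt_toNNReal_iff_coe_lt.2 hlt)
  · rw [hcdf x hx, Measure.map_apply_of_aemeasurable hS measurableSet_Iic]
    refine measure_mono_ae ?_
    filter_upwards [hU.ae_isRegularPath hν] with ω hω hlt
    exact (Real.le_toNNReal_iff_coe_le hx.le).1 (inverseSubordinator_le hω hlt)

end SubordinatedBS

namespace SubordinatedBS

/-! ### Expectations under the martingale measure -/

section martingaleMeasure

variable {Ω : Type*} {mΩ : MeasurableSpace Ω} {P : Measure Ω} {B : ℝ≥0 → Ω → ℝ}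

lemma aemeasurable_eval_random [IsProbabilityMeasure P] (hB : IsBrownianReal B P) {τ : Ω → ℝ≥0}
    (hτ : AEMeasurable τ P) : AEMeasurable (fun ω => B (τ ω) ω) P := by
  have hβ : AEMeasurable (fun ω => samplePath fun t => B t ω) P :=
    aemeasurable_pi_lambda _ fun p => hB.aemeasurable _
  refine (measurable_evalSample.comp_aemeasurable (hτ.prodMk hβ)).congr ?_
  filter_upwards [hB.cont] with ω hω
  exact evalSample_samplePath hω (τ ω)

lemma aemeasurable_girsanovDensity_random [IsProbabilityMeasure P] (hB : IsBrownianReal B P)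
    (c : ℝ) {τ : Ω → ℝ≥0} (hτ : AEMeasurable τ P) :
    AEMeasurable (fun ω => ENNReal.ofReal (girsanovDensity c B (τ ω) ω)) P := by
  have h1 : Measurable fun p : ℝ × ℝ≥0 =>
      ENNReal.ofReal (Real.exp (-c * p.1 - c ^ 2 / 2 * p.2)) := by fun_prop
  exact h1.comp_aemeasurable ((aemeasurable_eval_random hB hτ).prodMk hτ)

lemma martingaleMeasure_eq (r μ σ : ℝ) (τ : Ω → ℝ≥0) : martingaleMeasure P r μ σ B τ =
    P.withDensity fun ω => ENNReal.ofReal (girsanovDensity (gammaParam r μ σ) B (τ ω) ω) := rfl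

lemma toReal_ofReal_girsanovDensity (c : ℝ) (t : ℝ≥0) (ω : Ω) :
    (ENNReal.ofReal (girsanovDensity c B t ω)).toReal = girsanovDensity c B t ω :=
  ENNReal.toReal_ofReal (Real.exp_pos _).le

lemma integrable_martingaleMeasure_iff [IsProbabilityMeasure P] (hB : IsBrownianReal B P)
    (r μ σ : ℝ) {τ : Ω → ℝ≥0} (hτ : AEMeasurable τ P) {X : Ω → ℝ} :
    Integrable X (martingaleMeasure P r μ σ B τ) ↔
      Integrable (fun ω => girsanovDensity (gammaParam r μ σ) B (τ ω) ω * X ω) P := by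
  rw [martingaleMeasure_eq, integrable_withDensity_iff_integrable_smul₀'
    (aemeasurable_girsanovDensity_random hB _ hτ)
    (Filter.Eventually.of_forall fun ω => ENNReal.ofReal_lt_top)]
  simp only [toReal_ofReal_girsanovDensity, smul_eq_mul]

lemma integral_martingaleMeasure [IsProbabilityMeasure P] (hB : IsBrownianReal B P)
    (r μ σ : ℝ) {τ : Ω → ℝ≥0} (hτ : AEMeasurable τ P) (X : Ω → ℝ) :
    ∫ ω, X ω ∂(martingaleMeasure P r μ σ B τ) =
      ∫ ω, girsanovDensity (gammaParam r μ σ) B (τ ω) ω * X ω ∂P := by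
  rw [martingaleMeasure_eq, integral_withDensity_eq_integral_toReal_smul₀
    (aemeasurable_girsanovDensity_random hB _ hτ)
    (Filter.Eventually.of_forall fun ω => ENNReal.ofReal_lt_top)]
  simp only [toReal_ofReal_girsanovDensity, smul_eq_mul]

end martingaleMeasure

lemma integral_lookbackFormula_of_density {Ω : Type*} {mΩ : MeasurableSpace Ω} {P : Measure Ω}
    {Z₀ r σ a b : ℝ} {X : Ω → ℝ} {g : ℝ → ℝ} (hX : AEMeasurable X P) (ha : 0 ≤ a) (hb : 0 < b)
    (hg : Measurable g) (hg0 : ∀ z, 0 < z → 0 ≤ g z)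
    (hlaw : P.map X = (volume.restrict (Set.Ioi 0)).withDensity
      fun x => ENNReal.ofReal (a * g (x / b)))
    (hint : Integrable (fun ω => lookbackFormula Z₀ r σ (X ω)) P) :
    IntegrableOn (fun x => lookbackFormula Z₀ r σ x * a * g (x / b)) (Set.Ioi 0) ∧
      ∫ ω, lookbackFormula Z₀ r σ (X ω) ∂P =
        ∫ x in Set.Ioi (0 : ℝ), lookbackFormula Z₀ r σ x * a * g (x / b) := by
  have hL := measurable_lookbackFormula Z₀ r σ
  have hd : Measurable fun x => ENNReal.ofReal (a * g (x / b)) := by fun_prop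
  have htop : ∀ᵐ x ∂(volume.restrict (Set.Ioi 0)), ENNReal.ofReal (a * g (x / b)) < ∞ :=
    Filter.Eventually.of_forall fun x => ENNReal.ofReal_lt_top
  have heq : (fun x => (ENNReal.ofReal (a * g (x / b))).toReal • lookbackFormula Z₀ r σ x)
      =ᵐ[volume.restrict (Set.Ioi 0)] fun x => lookbackFormula Z₀ r σ x * a * g (x / b) := by
    filter_upwards [ae_restrict_mem measurableSet_Ioi] with x hx
    rw [ENNReal.toReal_ofReal (mul_nonneg ha (hg0 _ (div_pos hx hb))), smul_eq_mul]
    ring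
  constructor
  · have h1 : Integrable (lookbackFormula Z₀ r σ) (P.map X) :=
      (integrable_map_measure hL.aestronglyMeasurable hX).2 hint
    rw [hlaw, integrable_withDensity_iff_integrable_smul' hd htop] at h1
    exact h1.congr heq
  · rw [← integral_map hX hL.aestronglyMeasurable, hlaw,
      integral_withDensity_eq_integral_toReal_smul hd htop]
    exact integral_congr_ae heq

end SubordinatedBS

/-! ### The classical and subordinated prices -/

theorem mainTheorem6 {Ω : Type*} [MeasurableSpace Ω] (P : Measure Ω) [IsProbabilityMeasure P]
    (Z₀ r μ σ : ℝ) (hZ₀ : 0 < Z₀) (hr : r ≠ 0) (hσ : 0 < σ)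
    (ν : Measure ℝ) (hν : SubordinatedBS.IsInfiniteLevyMeasure ν)
    (U : ℝ≥0 → Ω → ℝ) (hU : SubordinatedBS.IsSubordinator U ν P)
    (S : ℝ≥0 → Ω → ℝ≥0) (hS : S = SubordinatedBS.inverseSubordinator U)
    (B : ℝ≥0 → Ω → ℝ) (hB : IsBrownianReal B P)
    (hSB : IndepFun (fun ω t ↦ S t ω) (fun ω t ↦ B t ω) P)
    (T : ℝ≥0) (hT : 0 < T) :
    -- the classical fair price is given by the semi-explicit formula
    (∀ τ : ℝ≥0,
      Integrable (SubordinatedBS.classicalDiscountedPayoff Z₀ r μ σ B τ)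
        (SubordinatedBS.martingaleMeasure P r μ σ B fun _ ↦ τ) ∧
      SubordinatedBS.classicalLookbackPrice P Z₀ r μ σ B τ =
        SubordinatedBS.lookbackFormula Z₀ r σ τ) ∧
    -- the subordinated fair price is `E C^L(S(T))`
    (Integrable (SubordinatedBS.subordinatedDiscountedPayoff Z₀ r μ σ B S T)
        (SubordinatedBS.martingaleMeasure P r μ σ B (S T)) ∧
      Integrable (fun ω ↦ SubordinatedBS.lookbackFormula Z₀ r σ (S T ω)) P ∧
      SubordinatedBS.subordinatedLookbackPrice P Z₀ r μ σ B S T =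
        ∫ ω, SubordinatedBS.lookbackFormula Z₀ r σ (S T ω) ∂P) ∧
    -- the stable case
    (∀ α : ℝ, 0 < α → α < 1 → (∀ u : ℝ, 0 < u → SubordinatedBS.laplaceExponent ν u = u ^ α) →
      ∃ g : ℝ → ℝ,
        (∀ z : ℝ, 0 < z → 0 ≤ g z ∧ ∀ c : ℝ, 0 < c →
          (g z : ℂ) = SubordinatedBS.foxH 1 0 ![1 - α] ![α] ![0] ![1] c z) ∧
        P.map (fun ω ↦ (S T ω : ℝ)) = (volume.restrict (Set.Ioi 0)).withDensity
          (fun x ↦ ENNReal.ofReal ((T : ℝ) ^ (-α) * g (x / (T : ℝ) ^ α))) ∧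
        IntegrableOn (fun x : ℝ ↦ SubordinatedBS.lookbackFormula Z₀ r σ x *
          (T : ℝ) ^ (-α) * g (x / (T : ℝ) ^ α)) (Set.Ioi 0) ∧
        SubordinatedBS.subordinatedLookbackPrice P Z₀ r μ σ B S T =
          ∫ x in Set.Ioi (0 : ℝ), SubordinatedBS.lookbackFormula Z₀ r σ x *
            (T : ℝ) ^ (-α) * g (x / (T : ℝ) ^ α)) := by
  subst hS
  have hSm := hU.aemeasurable_inverse hν T
  have hind : IndepFun (SubordinatedBS.inverseSubordinator U T) (fun ω t ↦ B t ω) P :=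
    hSB.comp (measurable_pi_apply T) measurable_id
  obtain ⟨h1, h2, h3⟩ := SubordinatedBS.integral_classicalDiscountedPayoff_random hB hZ₀ hr hσ
    (μ := μ) hSm hind
  have hae : (fun ω => SubordinatedBS.girsanovDensity (SubordinatedBS.gammaParam r μ σ) B
      (SubordinatedBS.inverseSubordinator U T ω) ω *
        SubordinatedBS.subordinatedDiscountedPayoff Z₀ r μ σ B
          (SubordinatedBS.inverseSubordinator U) T ω) =ᵐ[P] fun ω =>
      SubordinatedBS.girsanovDensity (SubordinatedBS.gammaParam r μ σ) B
      (SubordinatedBS.inverseSubordinator U T ω) ω *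
        SubordinatedBS.classicalDiscountedPayoff Z₀ r μ σ B
          (SubordinatedBS.inverseSubordinator U T ω) ω := by
    filter_upwards [hU.ae_isRegularPath hν] with ω hω
    rw [SubordinatedBS.subordinatedDiscountedPayoff_eq hω]
  have hprice : SubordinatedBS.subordinatedLookbackPrice P Z₀ r μ σ B
      (SubordinatedBS.inverseSubordinator U) T =
      ∫ ω, SubordinatedBS.lookbackFormula Z₀ r σ (SubordinatedBS.inverseSubordinator U T ω) ∂P := by
    rw [SubordinatedBS.subordinatedLookbackPrice,
      SubordinatedBS.integral_martingaleMeasure hB r μ σ hSm, integral_congr_ae hae, h3]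
  refine ⟨fun τ => ?_, ⟨?_, h2, hprice⟩, fun α hα hα1 hψ => ?_⟩
  · obtain ⟨h4, h5, -⟩ := SubordinatedBS.integral_classicalDiscountedPayoff hB hZ₀ hr hσ (μ := μ) τ
    exact ⟨(SubordinatedBS.integrable_martingaleMeasure_iff hB r μ σ aemeasurable_const).2 h4,
      (SubordinatedBS.integral_martingaleMeasure hB r μ σ aemeasurable_const _).trans h5⟩
  · exact (SubordinatedBS.integrable_martingaleMeasure_iff hB r μ σ hSm).2 (h1.congr hae.symm)
  · have hUp : IsProbabilityMeasure (P.map (U 1)) :=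
      Measure.isProbabilityMeasure_map (hU.aemeasurable 1)
    have hst := hU.isPositiveStable hν hψ one_pos
    rw [NNReal.coe_one] at hst
    obtain ⟨f, hf, hf0, hρ⟩ := hst.exists_density_map_logScaled hα hα1 one_pos
    have hT' : (0 : ℝ) < T := hT
    have hg0 : ∀ z : ℝ, 0 < z → 0 ≤ f (Real.log z) / z := fun z hz => div_nonneg (hf0 _) hz.le
    have hlaw := hU.map_inverse_eq hν hα hψ hρ hT
    obtain ⟨h4, h5⟩ := SubordinatedBS.integral_lookbackFormula_of_density
      (g := fun z => f (Real.log z) / z) hSm.coe_nnreal_real (Real.rpow_pos_of_pos hT' (-α)).le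
      (Real.rpow_pos_of_pos hT' α) (by fun_prop) hg0 hlaw h2
    -- With `f` the density of the logarithm of `U(1)^(-α)`, this is the density of `U(1)^(-α)`
    -- itself.
    exact ⟨fun z => f (Real.log z) / z, fun z hz => ⟨hg0 z hz, fun c hc =>
      hst.density_eq_foxH hα hα1 one_pos hf hf0 hρ hc hz⟩, hlaw, h4, hprice.trans h5⟩
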